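/- **Setting.** Fix integers $\mathfrak K,\mathfrak d\ge 0$. Let $H=\sum_{a=1}^m\lambda_aE_a$ be a Hamiltonian on $n$ qubits, where the $E_a$ are distinct non-identity tensor products of Pauli matrices, $|\mathrm{supp}(E_a)|\le\mathfrak K$, $\lambda_a\in[-1,1]$, and the dual interaction graph $\mathfrak G$ on $\{1,\dots,m\}$ (with $a\ne b$ adjacent iff $\mathrm{supp}(E_a)\cap\mathrm{supp}(E_b)\neq\varnothing$) has maximum degree at most $\mathfrak d$. For $r\in\mathbb N$ let $\mathcal P_r$ be the set of tensor products of Paulis $P$ for which there is a nonempty set $S\subset\{1,\dots,m\}$, connected in $\mathfrak G$, with $\mathfrak K|S|\le r$ and $\mathrm{supp}(P)\subset\bigcup_{a\in S}\mathrm{supp}(E_a)$. For $\beta>0$ let $\rho=e^{-\beta H}/\mathrm{tr}\,e^{-\beta H}$. For a real polynomial $p(x)=\sum_i p_ix^i$ put $p(X|A)=\sum_i p_i[X,A]_i$, where $[X,A]_0=A$ and $[X,A]_{i+1}=[X,[X,A]_i]$. For $\varepsilon,\eta\in(0,1)$ and $\kappa\ge1$, the polynomial $p$ is a $(\kappa,\eta,\varepsilon)$-flat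 exponential approximation if $|p(x)-e^x|\le\varepsilon$ for $x\in[-\kappa,\kappa]$ and $|p(x)|\le\max(1,e^x)e^{\eta|x|}$ for all $x\in\mathbb R$. $\|\cdot\|$ is the operator norm. **(1) Feasibility of the polynomial approximation.** There are constants $C,c>0$ depending only on $\mathfrak K,\mathfrak d$ such that for all $n,m$, all $H$ as above, all $\beta>0$, every $(\kappa,\eta,\varepsilon)$-flat exponential approximation $q$ with $\kappa\ge C\beta\log(1/\varepsilon)$ and $\eta<c/\beta$, and all $A,B\in\mathcal P_{\mathfrak K}$, $$|\mathrm{tr}(B\,q(-\beta H|A)\,\rho)-\mathrm{tr}(AB\rho)|\le 20\,\varepsilon\,\|A\|\,\|B\|.$$ **(2) Feasibility of the polynomial system.** There is $C_0>0$ depending only on $\mathfrak K,\mathfrak d$ such that the following holds for all $C\ge C_0$, all $n,m$, all $H$ as above, all $\beta>(10(\mathfrak d+1))^{-10}$ and all $\varepsilon\in(0,1/2]$. Put $K=\lceil C\beta\rceil$, $\ell_0=\lceil 2^{K}\log(1/\varepsilon)\rceil$, $\varepsilon_0=\varepsilon^{10^{K}}/m^3$, $\mathcal A=\mathcal P_{4^K\ell_0}$,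 $\mathcal B=\mathcal P_{4\mathfrak K}$, and $$q(x)=1+\int_0^x\prod_{j=1}^{K}s_{2^j\ell_0}(y/K)\,dy,\qquad s_\ell(x)=\sum_{i=0}^{\ell}\frac{x^i}{i!}.$$ Let $\delta\le\varepsilon_0$ and $\tau\ge 2m\delta$, and let $M\mapsto\widetilde{\mathrm{tr}}(M\rho)$ be a linear functional on operators with $|\widetilde{\mathrm{tr}}(A_1A_2A_3\rho)-\mathrm{tr}(A_1A_2A_3\rho)|\le\delta$ for all $A_1,A_2,A_3\in\mathcal A$. Then the true coefficients $\lambda'=\lambda$ satisfy the following system, in which $H'=\sum_a\lambda'_aE_a$: * $-1\le\lambda'_a\le1$ for all $a$; * $|\widetilde{\mathrm{tr}}((A_1A_2H'-H'A_1A_2)\rho)|^2\le\tau^2$ for all $A_1,A_2\in\mathcal A$; * $|\widetilde{\mathrm{tr}}(B_2\,q(-\beta H'|B_1)\,\rho)-\widetilde{\mathrm{tr}}(B_1B_2\rho)|^2\le\varepsilon^2$ for all $B_1,B_2\in\mathcal B$. In particular the commutator constraints hold with tolerance $\tau=\varepsilon_0$ if the estimates are accurate to $\varepsilon_0/(2m)$,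 and with tolerance $2m\varepsilon_0$ if they are accurate to $\varepsilon_0$. -/

import Mathlib

open scoped Matrix Polynomial

noncomputable section

namespace HamiltonianLearning

/-! ### Pauli operators on `n` qubits -/

/-- Operators on the `2 ^ n`-dimensional Hilbert space of `n` qubits. -/
abbrev Op (n : ℕ) : Type := Matrix (Fin n → Fin 2) (Fin n → Fin 2) ℂ

/-- The four Pauli matrices; `0, 1, 2, 3` stand for the identity, `x`, `y`, `z`. -/
def sigma : Fin 4 → Matrix (Fin 2) (Fin 2) ℂ :=
  ![1, !![0, 1; 1, 0], !![0, -Complex.I; Complex.I, 0], !![1, 0; 0, -1]]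

/-- A tensor product of Pauli matrices, given by its tensor factors. -/
abbrev PauliString (n : ℕ) : Type := Fin n → Fin 4

/-- The operator `P₁ ⊗ ⋯ ⊗ Pₙ`. -/
def PauliString.op {n : ℕ} (P : PauliString n) : Op n :=
  Matrix.of fun x y => ∏ i, sigma (P i) (x i) (y i)

/-- The qubits on which `P` acts non-trivially. -/
def PauliString.supp {n : ℕ} (P : PauliString n) : Finset (Fin n) :=
  Finset.univ.filter fun i => P i ≠ 0

/-- The operator norm for the Euclidean norm on the Hilbert space. -/
def opNorm {n : ℕ} (A : Op n) : ℝ := ‖Matrix.toEuclideanCLM (𝕜 := ℂ) A‖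

/-! ### Local Hamiltonians -/

/-- The dual interaction graph: distinct terms are adjacent when their supports meet. -/
def dualGraph {n m : ℕ} (E : Fin m → PauliString n) : SimpleGraph (Fin m) where
  Adj a b := a ≠ b ∧ ((E a).supp ∩ (E b).supp).Nonempty
  symm := ⟨fun a b h => ⟨h.1.symm, by rw [Finset.inter_comm]; exact h.2⟩⟩
  loopless := ⟨fun _ h => h.1 rfl⟩

/-- A `k`-local Hamiltonian `∑ a, coeff a • term a` on `n` qubits, whose `m` terms are distinct
non-identity Pauli operators, whose coefficients are in `[-1, 1]`, and whose dual interaction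
graph has maximum degree at most `d`. -/
structure LocalHamiltonian (n m k d : ℕ) where
  term : Fin m → PauliString n
  coeff : Fin m → ℝ
  term_injective : Function.Injective term
  term_ne_one : ∀ a, term a ≠ 0
  abs_coeff_le : ∀ a, |coeff a| ≤ 1
  card_supp_le : ∀ a, (term a).supp.card ≤ k
  degree_le : ∀ a, ((dualGraph term).neighborSet a).ncard ≤ d

/-- The operator `∑ a, c a • E a`. -/
def hamOp {n m : ℕ} (E : Fin m → PauliString n) (c : Fin m → ℝ) : Op n :=
  ∑ a, (c a : ℂ) • (E a).op

/-- The operator of a local Hamiltonian. -/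
def LocalHamiltonian.op {n m k d : ℕ} (H : LocalHamiltonian n m k d) : Op n :=
  hamOp H.term H.coeff

/-- The Gibbs state `exp (-β H) / tr (exp (-β H))`. -/
def gibbs {n : ℕ} (β : ℝ) (H : Op n) : Op n :=
  (Matrix.trace (NormedSpace.exp (-(β : ℂ) • H)))⁻¹ • NormedSpace.exp (-(β : ℂ) • H)

/-- The Paulis that are `r`-local with respect to the dual interaction graph of the terms `E`
(each of which acts on at most `k` qubits): the support is covered by the supports of the terms
in a (nonempty) connected set `S` of terms with `k * #S ≤ r`.  For `r = k` the set `S` is one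
term. -/
def graphLocal {n m : ℕ} (E : Fin m → PauliString n) (k r : ℕ) : Set (PauliString n) :=
  {P | ∃ S : Finset (Fin m), ((dualGraph E).induce (S : Set (Fin m))).Connected ∧
    k * S.card ≤ r ∧ P.supp ⊆ S.biUnion fun a => (E a).supp}

/-! ### Commutator polynomials -/

/-- The nested commutator `[X, [X, … [X, A]]]` with `i` copies of `X`. -/
def nestedComm {n : ℕ} (X A : Op n) : ℕ → Op n
  | 0 => A
  | i + 1 => X * nestedComm X A i - nestedComm X A i * X

/-- `p(X | A) = ∑ i, pᵢ [X, A]ᵢ`, where `[X, A]₀ = A`. -/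
def commPoly {n : ℕ} (p : ℝ[X]) (X A : Op n) : Op n :=
  p.sum fun i a => (a : ℂ) • nestedComm X A i

/-! ### Flat approximations of the exponential -/

/-- `p` is a `(κ, η, ε)`-flat approximation of the exponential function. -/
structure IsFlatExpApprox (p : ℝ[X]) (κ η ε : ℝ) : Prop where
  eps_mem : ε ∈ Set.Ioo (0 : ℝ) 1
  eta_mem : η ∈ Set.Ioo (0 : ℝ) 1
  one_le_kappa : 1 ≤ κ
  approx : ∀ x ∈ Set.Icc (-κ) κ, |p.eval x - Real.exp x| ≤ ε
  flat : ∀ x : ℝ, |p.eval x| ≤ max 1 (Real.exp x) * Real.exp (η * |x|)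

/-- The Taylor polynomial `∑_{i ≤ l} xⁱ / i!` of the exponential function. -/
def expTaylor (l : ℕ) : ℝ[X] :=
  ∑ i ∈ Finset.range (l + 1), Polynomial.monomial i (1 / (i.factorial : ℝ))

/-- `p_{k,l}(x) = s_{2l}(x/k) s_{4l}(x/k) ⋯ s_{2ᵏl}(x/k)`, with `s` the Taylor polynomials. -/
def iterTaylor (k l : ℕ) : ℝ[X] :=
  ∏ j ∈ Finset.Icc 1 k,
    (expTaylor (2 ^ j * l)).comp (Polynomial.C (1 / (k : ℝ)) * Polynomial.X)

/-- The antiderivative of a polynomial that vanishes at `0`. -/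
def antideriv (p : ℝ[X]) : ℝ[X] :=
  p.sum fun i a => Polynomial.monomial (i + 1) (a / ((i : ℝ) + 1))

/-- `q_{k,l}(x) = 1 + ∫₀ˣ p_{k,l}(y) dy`. -/
def iterTaylorInt (k l : ℕ) : ℝ[X] := 1 + antideriv (iterTaylor k l)

theorem iterTaylorInt_eval (k l : ℕ) (x : ℝ) :
    (iterTaylorInt k l).eval x = 1 + ∫ y in (0 : ℝ)..x, (iterTaylor k l).eval y := by
  have key : ∀ p : ℝ[X], (antideriv p).eval x = ∫ y in (0 : ℝ)..x, p.eval y := by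
    intro p
    have h : ∀ y : ℝ, p.eval y = ∑ i ∈ p.support, p.coeff i * y ^ i := fun y => by
      rw [Polynomial.eval_eq_sum, Polynomial.sum]
    simp only [h]
    rw [intervalIntegral.integral_finsetSum (fun i _ => Continuous.intervalIntegrable
      (by fun_prop) _ _)]
    rw [antideriv, Polynomial.sum, Polynomial.eval_finsetSum]
    refine Finset.sum_congr rfl fun i _ => ?_
    rw [intervalIntegral.integral_const_mul, integral_pow, Polynomial.eval_monomial]
    simp
    ring
  simp [iterTaylorInt, key]

/-! ### The polynomial system

Below `K = ⌈C β⌉` and `ℓ₀ = ⌈2 ^ K log (1/ε)⌉`, where `C` is a constant depending on the locality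
and the degree only. -/

/-- The integer `⌈C β⌉`. -/
def sysK (C β : ℝ) : ℕ := ⌈C * β⌉₊

/-- The integer `ℓ₀ = ⌈2 ^ K log (1/ε)⌉`. -/
def sysL (K : ℕ) (ε : ℝ) : ℕ := ⌈(2 : ℝ) ^ K * Real.log (1 / ε)⌉₊

/-- The accuracy `ε₀ = ε ^ (10 ^ K) / m ^ 3` of the trace estimates. -/
def sysEps (K m : ℕ) (ε : ℝ) : ℝ := ε ^ (10 ^ K) / (m : ℝ) ^ 3

/-- The set `𝒜` of `(4 ^ K ℓ₀)`-local Paulis. -/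
def sysA {n m : ℕ} (E : Fin m → PauliString n) (k K : ℕ) (ε : ℝ) : Set (PauliString n) :=
  graphLocal E k (4 ^ K * sysL K ε)

/-- The set `ℬ` of `4k`-local Paulis. -/
def sysB {n m : ℕ} (E : Fin m → PauliString n) (k : ℕ) : Set (PauliString n) :=
  graphLocal E k (4 * k)

/-- The linear functional `T` (an estimate of `M ↦ tr (M ρ)`) is `δ`-accurate on the products of
three Paulis in `S`.  Only the values of `T` on the span of these products are constrained, and
every linear functional on that span extends to all operators. -/
def AccurateEstimates {n : ℕ} (T : Op n →ₗ[ℂ] ℂ) (ρ : Op n) (S : Set (PauliString n))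
    (δ : ℝ) : Prop :=
  ∀ A₁ ∈ S, ∀ A₂ ∈ S, ∀ A₃ ∈ S,
    ‖T (A₁.op * A₂.op * A₃.op) - Matrix.trace (A₁.op * A₂.op * A₃.op * ρ)‖ ≤ δ

/-- The point `μ` satisfies the polynomial system in the unknown coefficients of
`H' = ∑ a, μ a • E a` that is built from the estimates `T`; `τ` is the tolerance of the commutator
constraints.  As `tr (A₁ A₂ (H' ρ - ρ H')) = tr ((A₁ A₂ H' - H' A₁ A₂) ρ)`, the estimate of the
left side is `T (A₁ A₂ H' - H' A₁ A₂)`. -/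
structure SatisfiesSystem {n m : ℕ} (E : Fin m → PauliString n) (k K : ℕ) (β ε τ : ℝ)
    (T : Op n →ₗ[ℂ] ℂ) (μ : Fin m → ℝ) : Prop where
  box : ∀ a, -1 ≤ μ a ∧ μ a ≤ 1
  commutator : ∀ A₁ ∈ sysA E k K ε, ∀ A₂ ∈ sysA E k K ε,
    ‖T (A₁.op * A₂.op * hamOp E μ - hamOp E μ * (A₁.op * A₂.op))‖ ^ 2 ≤ τ ^ 2
  exponential : ∀ B₁ ∈ sysB E k, ∀ B₂ ∈ sysB E k,
    ‖T (B₂.op * commPoly (iterTaylorInt K (sysL K ε)) (-(β : ℂ) • hamOp E μ) B₁.op)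
      - T (B₁.op * B₂.op)‖ ^ 2 ≤ ε ^ 2

end HamiltonianLearning

end

open HamiltonianLearning

namespace HamiltonianLearning

/-! In an eigenbasis of `H` with eigenvalues `h i`, the operator `q(-βH|A)` has entries `q(-β(h i -
h j)) A i j`. Since `exp(-β(h i - h j)) ρ j = ρ i` for the Gibbs weights, `tr(ABρ)` is the same
double sum as `tr(B q(-βH|A) ρ)` with `exp` in place of `q`. The difference is therefore controlled
by `|q(x) - exp x| ρ j` at `x = -β(h i - h j)`, summed against `|B i j| |A i j|`.

For `|x| ≤ κ` the approximation error is at most `ε`. For `|x| > κ` flatness leaves a factor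
`exp(η|x|)`, times `max(1, exp x) ρ j = max(ρ j, ρ i)`. Locality pays for this factor: nested
commutators of a local Pauli with `H` grow at most like `i! G ^ i` with `G = 8(d+1)`, so the
imaginary time evolution of `A` stays bounded up to time `1/(3G)`, and `A i j` decays exponentially
in the energy gap `|h i - h j|`, in the mean square of each column. This gives
`IsFlatExpApprox.norm_trace_commPoly_sub_le`, which is part (1) up to constants.

For part (2), `isFlatExpApprox_iterTaylorInt` shows that the explicit polynomial is flat with `η =
114/K`. At the true coefficients the commutator constraints have exact value `0`, because `H`
commutes with `ρ`, and the exponential constraints are nearly exact by part (1). What remains is the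
error of the estimates: expanding in Paulis multiplies `δ` by `2m` in the commutator constraints and
by at most `K ^ (deg + 1)` in the exponential ones, which `ε ^ (10 ^ K)` absorbs. -/

/-! ### Truncations of the exponential series -/

/-- The coefficients of `p` lie between `0` and those of `exp (c x)`, and agree with the latter
up to degree `N`. -/
def IsExpTrunc (p : ℝ[X]) (c : ℝ) (N : ℕ) : Prop :=
  ∀ i, 0 ≤ p.coeff i ∧ p.coeff i ≤ c ^ i / (i.factorial : ℝ) ∧
    (i ≤ N → p.coeff i = c ^ i / (i.factorial : ℝ))

theorem sum_antidiagonal_pow_div_factorial (c c' : ℝ) (n : ℕ) :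
    ∑ x ∈ Finset.HasAntidiagonal.antidiagonal n,
      c ^ x.1 / (x.1.factorial : ℝ) * (c' ^ x.2 / (x.2.factorial : ℝ))
      = (c + c') ^ n / (n.factorial : ℝ) := by
  rw [(Commute.all c c').add_pow', Finset.sum_div]
  refine Finset.sum_congr rfl fun x hx => ?_
  have hx' : x.1 + x.2 = n := Finset.HasAntidiagonal.mem_antidiagonal.1 hx
  have h := Nat.choose_mul_factorial_mul_factorial (n := n) (k := x.1) (by omega)
  have h2 : n - x.1 = x.2 := by omega
  rw [h2] at h
  have h3 : (n.choose x.1 : ℝ) * x.1.factorial * x.2.factorial = n.factorial := by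
    exact_mod_cast h
  have := Nat.factorial_ne_zero n
  rw [nsmul_eq_mul, ← h3]
  have : (n.choose x.1 : ℝ) ≠ 0 := by
    have := Nat.choose_pos (n := n) (k := x.1) (by omega)
    positivity
  field_simp

/-- The series of `exp (c x)` and `exp (c' x)` multiply to that of `exp ((c + c') x)`, and a Cauchy
product coefficient is monotone in nonnegative factors. Its `i`-th coefficient only involves indices
up to `i`, so agreement up to `N` survives. -/
theorem IsExpTrunc.mul {p q : ℝ[X]} {c c' : ℝ} {N : ℕ} (hc : 0 ≤ c)
    (hp : IsExpTrunc p c N) (hq : IsExpTrunc q c' N) : IsExpTrunc (p * q) (c + c') N := by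
  intro i
  rw [Polynomial.coeff_mul, ← sum_antidiagonal_pow_div_factorial]
  refine ⟨Finset.sum_nonneg fun x _ => mul_nonneg (hp _).1 (hq _).1,
    Finset.sum_le_sum fun x _ => mul_le_mul (hp _).2.1 (hq _).2.1 (hq _).1 (by positivity),
    fun hi => Finset.sum_congr rfl fun x hx => ?_⟩
  have hx' : x.1 + x.2 = i := Finset.HasAntidiagonal.mem_antidiagonal.1 hx
  rw [(hp x.1).2.2 (by omega), (hq x.2).2.2 (by omega)]

theorem IsExpTrunc.one (N : ℕ) : IsExpTrunc 1 0 N := by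
  intro i
  rcases i with _ | i <;> simp [Polynomial.coeff_one]

theorem IsExpTrunc.prod {ι : Type*} (s : Finset ι) {p : ι → ℝ[X]} {c : ℝ} {N : ℕ} (hc : 0 ≤ c)
    (hp : ∀ j ∈ s, IsExpTrunc (p j) c N) : IsExpTrunc (∏ j ∈ s, p j) (s.card * c) N := by
  classical
  induction s using Finset.induction_on with
  | empty => simpa using IsExpTrunc.one N
  | insert a s ha ih =>
    rw [Finset.prod_insert ha, Finset.card_insert_of_notMem ha]
    have := (hp a (by simp)).mul hc (ih fun j hj => hp j (by simp [hj]))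
    convert this using 1
    push_cast
    ring

theorem expTaylor_coeff (l i : ℕ) :
    (expTaylor l).coeff i = if i ≤ l then 1 / (i.factorial : ℝ) else 0 := by
  simp only [expTaylor, Polynomial.finsetSum_coeff, Polynomial.coeff_monomial]
  rw [Finset.sum_ite_eq']
  simp

theorem isExpTrunc_expTaylor_comp {c : ℝ} (hc : 0 ≤ c) {l N : ℕ} (h : N ≤ l) :
    IsExpTrunc ((expTaylor l).comp (Polynomial.C c * Polynomial.X)) c N := by
  intro i
  rw [Polynomial.comp_C_mul_X_coeff, expTaylor_coeff]
  have h0 : 0 ≤ c ^ i / (i.factorial : ℝ) := by positivity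
  refine ⟨?_, ?_, fun hi => ?_⟩
  · split_ifs <;> positivity
  · split_ifs
    · exact le_of_eq (by ring)
    · simpa using h0
  · rw [if_pos (by omega)]
    ring

theorem isExpTrunc_expTaylor (l : ℕ) : IsExpTrunc (expTaylor l) 1 l := by
  simpa using isExpTrunc_expTaylor_comp (c := 1) zero_le_one (le_refl l)

/-- The `K` rates `1/K` add up to `1`; the shortest factor, `j = 1`, determines the order of
agreement. -/
theorem isExpTrunc_iterTaylor {K : ℕ} (hK : 1 ≤ K) (l : ℕ) :
    IsExpTrunc (iterTaylor K l) 1 (2 * l) := by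
  have h := IsExpTrunc.prod (Finset.Icc 1 K) (c := 1 / (K : ℝ)) (N := 2 * l)
    (p := fun j => (expTaylor (2 ^ j * l)).comp (Polynomial.C (1 / (K : ℝ)) * Polynomial.X))
    (by positivity) fun j hj => isExpTrunc_expTaylor_comp (by positivity) (by
      have := Nat.pow_le_pow_right (n := 2) (by norm_num) (Finset.mem_Icc.1 hj).1
      exact Nat.mul_le_mul_right l (by simpa using this))
  have h2 : ((Finset.Icc 1 K).card : ℝ) * (1 / K) = 1 := by
    have : (K : ℝ) ≠ 0 := by positivity
    simp [this]
  rw [h2] at h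
  exact h

theorem antideriv_coeff_zero (p : ℝ[X]) : (antideriv p).coeff 0 = 0 := by
  simp [antideriv, Polynomial.sum, Polynomial.finsetSum_coeff, Polynomial.coeff_monomial]

theorem antideriv_coeff_succ (p : ℝ[X]) (i : ℕ) :
    (antideriv p).coeff (i + 1) = p.coeff i / ((i : ℝ) + 1) := by
  simp only [antideriv, Polynomial.sum, Polynomial.finsetSum_coeff, Polynomial.coeff_monomial,
    add_left_inj]
  rw [Finset.sum_ite_eq']
  split_ifs with h
  · rfl
  · simp [Polynomial.notMem_support_iff.1 h]

theorem isExpTrunc_iterTaylorInt {K : ℕ} (hK : 1 ≤ K) (l : ℕ) :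
    IsExpTrunc (iterTaylorInt K l) 1 (2 * l + 1) := by
  intro i
  rw [iterTaylorInt, Polynomial.coeff_add]
  rcases i with _ | i
  · simp [antideriv_coeff_zero]
  · obtain ⟨h0, h1, h2⟩ := isExpTrunc_iterTaylor hK l i
    have e : (1 : ℝ) ^ (i + 1) / ((i + 1).factorial : ℝ)
        = 1 ^ i / (i.factorial : ℝ) / ((i : ℝ) + 1) := by
      rw [Nat.factorial_succ]
      push_cast
      field_simp
      simp
    rw [antideriv_coeff_succ, e, Polynomial.coeff_one, if_neg (by omega), zero_add]
    refine ⟨by positivity, by gcongr, fun hi => ?_⟩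
    rw [h2 (by omega)]

theorem natDegree_expTaylor_le (l : ℕ) : (expTaylor l).natDegree ≤ l :=
  Polynomial.natDegree_le_iff_coeff_eq_zero.2 fun i hi => by
    rw [expTaylor_coeff, if_neg (by omega)]

/-- The degrees `2 ^ j * l` form a geometric sum. The spare `2 * l` makes room for the degree gained
by integrating. -/
theorem natDegree_iterTaylor_le (K l : ℕ) : (iterTaylor K l).natDegree + 2 * l ≤ 2 ^ (K + 1) * l := by
  induction K with
  | zero => simp [iterTaylor]
  | succ K ih =>
    have h1 : ∀ (c : ℝ) (N : ℕ),
        ((expTaylor N).comp (Polynomial.C c * Polynomial.X)).natDegree ≤ N := fun c N =>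
      Polynomial.natDegree_comp_le.trans ((Nat.mul_le_mul (natDegree_expTaylor_le N)
        (Polynomial.natDegree_C_mul_le c _)).trans (by simp))
    have h2 : ∀ K : ℕ, ∑ j ∈ Finset.Icc 1 K, 2 ^ j * l + 2 * l ≤ 2 ^ (K + 1) * l := by
      intro K
      induction K with
      | zero => simp
      | succ K ih =>
        rw [Finset.sum_Icc_succ_top (by omega)]
        calc _ = (∑ j ∈ Finset.Icc 1 K, 2 ^ j * l + 2 * l) + 2 ^ (K + 1) * l := by ring
          _ ≤ 2 ^ (K + 1) * l + 2 ^ (K + 1) * l := by gcongr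
          _ = _ := by ring
    refine le_trans ?_ (h2 (K + 1))
    gcongr
    exact (Polynomial.natDegree_prod_le _ _).trans (Finset.sum_le_sum fun j _ => h1 _ _)

theorem natDegree_iterTaylorInt_le (K : ℕ) {l : ℕ} (hl : 1 ≤ l) :
    (iterTaylorInt K l).natDegree ≤ 2 ^ (K + 1) * l := by
  refine Polynomial.natDegree_le_iff_coeff_eq_zero.2 fun i hi => ?_
  have h := natDegree_iterTaylor_le K l
  obtain ⟨i, rfl⟩ : ∃ j, i = j + 1 := ⟨i - 1, by omega⟩
  rw [iterTaylorInt, Polynomial.coeff_add, antideriv_coeff_succ, Polynomial.coeff_one,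
    if_neg (by omega), Polynomial.coeff_eq_zero_of_natDegree_lt (by omega)]
  simp

/-! ### Errors of truncated exponential series -/

theorem hasSum_pow_div_factorial (x : ℝ) :
    HasSum (fun i : ℕ => x ^ i / (i.factorial : ℝ)) (Real.exp x) := by
  rw [Real.exp_eq_exp_ℝ]
  simpa only [div_eq_inv_mul, smul_eq_mul] using
    NormedSpace.exp_series_hasSum_exp' (𝕂 := ℝ) x

/-- The tail of the exponential series from `N` on, with `(i + N)! ≥ N! i!`. -/
theorem norm_le_of_hasSum_of_le_pow_div_factorial {f : ℕ → ℝ} {a y : ℝ} {N : ℕ}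
    (hf : HasSum f a) (hy : 0 ≤ y) (h0 : ∀ i < N, f i = 0)
    (h1 : ∀ i, |f i| ≤ y ^ i / (i.factorial : ℝ)) :
    |a| ≤ y ^ N / (N.factorial : ℝ) * Real.exp y := by
  have hs : HasSum (fun i => f (i + N)) a := by
    have := (hasSum_nat_add_iff' N).2 hf
    rwa [Finset.sum_eq_zero fun i hi => h0 i (Finset.mem_range.1 hi), sub_zero] at this
  have hg := (hasSum_pow_div_factorial y).mul_left (y ^ N / (N.factorial : ℝ))
  rw [← hs.tsum_eq, ← Real.norm_eq_abs]
  refine tsum_of_norm_bounded hg fun i => (h1 _).trans ?_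
  have : ((N.factorial : ℝ) * i.factorial) ≤ (i + N).factorial := by
    have := Nat.le_of_dvd (Nat.factorial_pos _) (Nat.factorial_mul_factorial_dvd_factorial_add i N)
    rw [mul_comm] at this
    exact_mod_cast this
  rw [div_mul_div_comm, ← pow_add, add_comm N i]
  gcongr

theorem hasSum_coeff_mul_pow (p : ℝ[X]) (x : ℝ) :
    HasSum (fun i => p.coeff i * x ^ i) (p.eval x) := by
  rw [Polynomial.eval_eq_sum_range]
  exact hasSum_sum_of_ne_finset_zero fun i hi => by
    rw [Polynomial.coeff_eq_zero_of_natDegree_lt (by simpa using hi), zero_mul]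

theorem IsExpTrunc.abs_eval_sub_exp_le {p : ℝ[X]} {N : ℕ} (hp : IsExpTrunc p 1 N) (x : ℝ) :
    |p.eval x - Real.exp x| ≤ |x| ^ (N + 1) / ((N + 1).factorial : ℝ) * Real.exp |x| := by
  refine norm_le_of_hasSum_of_le_pow_div_factorial
    ((hasSum_coeff_mul_pow p x).sub (hasSum_pow_div_factorial x)) (abs_nonneg x)
    (fun i hi => ?_) fun i => ?_
  · rw [(hp i).2.2 (by omega)]
    ring
  · obtain ⟨h0, h1, -⟩ := hp i
    rw [one_pow] at h1
    have e : p.coeff i * x ^ i - x ^ i / (i.factorial : ℝ)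
        = -((1 / (i.factorial : ℝ) - p.coeff i) * x ^ i) := by ring
    rw [e, abs_neg, abs_mul, abs_pow, abs_of_nonneg (by linarith),
      div_eq_mul_one_div (|x| ^ i), mul_comm (|x| ^ i)]
    exact mul_le_mul_of_nonneg_right (by linarith) (by positivity)

theorem IsExpTrunc.eval_nonneg {p : ℝ[X]} {N : ℕ} (hp : IsExpTrunc p 1 N) {x : ℝ} (hx : 0 ≤ x) :
    0 ≤ p.eval x :=
  (hasSum_coeff_mul_pow p x).nonneg fun i => mul_nonneg (hp i).1 (by positivity)

theorem IsExpTrunc.eval_le_exp {p : ℝ[X]} {N : ℕ} (hp : IsExpTrunc p 1 N) {x : ℝ} (hx : 0 ≤ x) :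
    p.eval x ≤ Real.exp x :=
  hasSum_le (fun i => by
    have := (hp i).2.1
    rw [one_pow] at this
    rw [div_eq_inv_mul, ← one_div]
    exact mul_le_mul_of_nonneg_right this (by positivity)) (hasSum_coeff_mul_pow p x) (hasSum_pow_div_factorial x)

/-- Stirling in the form `N ^ N / N! ≤ exp N`; the numerical fact behind the constants is `e ^ 2 /
16 < 1/2`. -/
theorem pow_div_factorial_mul_exp_le {x : ℝ} (hx : 0 ≤ x) {N : ℕ} (h : 16 * x ≤ N) :
    x ^ N / (N.factorial : ℝ) * Real.exp x ≤ (1 / 2) ^ N := by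
  have h1 : x ^ N / (N.factorial : ℝ) ≤ (1 / 16) ^ N * Real.exp N := by
    calc x ^ N / (N.factorial : ℝ) ≤ (N / 16 : ℝ) ^ N / (N.factorial : ℝ) := by
          gcongr
          linarith
      _ = (1 / 16) ^ N * ((N : ℝ) ^ N / (N.factorial : ℝ)) := by
          rw [div_eq_mul_one_div (N : ℝ) 16, mul_pow]
          ring
      _ ≤ _ := by
          gcongr
          exact Real.pow_div_factorial_le_exp _ (by positivity) _
  have h2 : Real.exp x ≤ Real.exp N := Real.exp_le_exp.2 (by linarith)
  have h3 : Real.exp (N : ℝ) = Real.exp 1 ^ N := by rw [← Real.exp_nat_mul, mul_one]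
  calc x ^ N / (N.factorial : ℝ) * Real.exp x
      ≤ (1 / 16) ^ N * Real.exp N * Real.exp N := by gcongr
    _ = (1 / 16 * Real.exp 1 * Real.exp 1) ^ N := by rw [h3, mul_pow, mul_pow]
    _ ≤ (1 / 2) ^ N := by
        gcongr
        have h4 := Real.exp_one_lt_d9
        have := Real.exp_pos 1
        nlinarith

/-! ### Growth of the iterated Taylor polynomial on the negative axis -/

/-- Writing `z ^ i = r ^ i (z / r) ^ i` uses the bounded degree to slow down the exponential; `r` is
a free parameter. -/
theorem abs_eval_expTaylor_le_pow_mul_exp (N : ℕ) {z r : ℝ} (hz : 0 ≤ z) (hr : 1 ≤ r) :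
    |(expTaylor N).eval (-z)| ≤ r ^ N * Real.exp (z / r) := by
  have e : (expTaylor N).eval (-z)
      = ∑ i ∈ Finset.range (N + 1), (-z) ^ i / (i.factorial : ℝ) := by
    simp [expTaylor, Polynomial.eval_finsetSum, div_eq_inv_mul]
  rw [e]
  have h2 := Real.sum_le_exp_of_nonneg (x := z / r) (by positivity) (N + 1)
  calc _ ≤ ∑ i ∈ Finset.range (N + 1), |(-z) ^ i / (i.factorial : ℝ)| :=
        Finset.abs_sum_le_sum_abs _ _
    _ ≤ ∑ i ∈ Finset.range (N + 1), r ^ N * ((z / r) ^ i / (i.factorial : ℝ)) := by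
        refine Finset.sum_le_sum fun i hi => ?_
        rw [abs_div, abs_pow, abs_neg, abs_of_nonneg hz, Nat.abs_cast, ← mul_div_assoc]
        gcongr
        have hi' : i ≤ N := by simpa [Nat.lt_succ_iff] using hi
        calc z ^ i = r ^ i * (z / r) ^ i := by
              rw [← mul_pow]
              congr 1
              field_simp
          _ ≤ r ^ N * (z / r) ^ i := by
              gcongr
    _ ≤ _ := by
        rw [← Finset.mul_sum]
        gcongr

/-- Below its range of accuracy a Taylor polynomial grows subexponentially: take `r = √(16 z / N)`
in the preceding bound and use `r ≤ exp r`. -/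
theorem abs_eval_expTaylor_le_exp_sqrt {N : ℕ} (hN : 1 ≤ N) {z : ℝ} (hz : 0 ≤ z)
    (h : (N : ℝ) ≤ 16 * z) :
    |(expTaylor N).eval (-z)| ≤ Real.exp (2 * (√(16 * z) * √N)) := by
  set v := √(16 * z)
  set w := √(N : ℝ)
  have hw : 0 < w := Real.sqrt_pos.2 (by positivity)
  have hwv : w ≤ v := Real.sqrt_le_sqrt h
  have hv2 : v ^ 2 = 16 * z := Real.sq_sqrt (by positivity)
  have hw2 : w ^ 2 = N := Real.sq_sqrt (by positivity)
  have hr : 1 ≤ v / w := (one_le_div hw).2 hwv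
  refine (abs_eval_expTaylor_le_pow_mul_exp N hz hr).trans ?_
  have h1 : (v / w) ^ N ≤ Real.exp (v * w) := by
    have : v / w ≤ Real.exp (v / w) := by linarith [Real.add_one_le_exp (v / w)]
    calc (v / w) ^ N ≤ Real.exp (v / w) ^ N := by gcongr
      _ = Real.exp (N * (v / w)) := by rw [Real.exp_nat_mul]
      _ = _ := by
        congr 1
        rw [← hw2]
        field_simp
  have h2 : z / (v / w) ≤ v * w := by
    have hv : 0 < v := hw.trans_le hwv
    rw [div_div_eq_mul_div, div_le_iff₀ hv]
    nlinarith
  calc _ ≤ Real.exp (v * w) * Real.exp (v * w) := by gcongr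
    _ = _ := by rw [← Real.exp_add]; ring_nf

theorem abs_eval_expTaylor_le_exp_pow {N : ℕ} {z : ℝ} (hz : 0 ≤ z) (h : 16 * z ≤ N) :
    |(expTaylor N).eval (-z)| ≤ Real.exp (z * (1 / 2) ^ N) := by
  have h1 := (isExpTrunc_expTaylor N).abs_eval_sub_exp_le (-z)
  rw [abs_neg, abs_of_nonneg hz] at h1
  have h2 : z ^ (N + 1) / ((N + 1).factorial : ℝ) * Real.exp z ≤ z * (1 / 2) ^ N := by
    calc _ ≤ z ^ (N + 1) / (N.factorial : ℝ) * Real.exp z := by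
          gcongr
          exact Nat.le_succ N
      _ = z * (z ^ N / (N.factorial : ℝ) * Real.exp z) := by ring
      _ ≤ _ := by
          gcongr
          exact pow_div_factorial_mul_exp_le hz h
  have h3 : Real.exp (-z) ≤ 1 := Real.exp_le_one_iff.2 (by linarith)
  have h4 := Real.exp_pos (-z)
  have h5 := Real.add_one_le_exp (z * (1 / 2) ^ N)
  rw [abs_le] at h1 ⊢
  constructor <;> linarith [h1.1, h1.2]

/-- When all the degrees are small relative to `z`, the exponents grow geometrically with ratio
`√2`, so the last one dominates the sum. -/
theorem prod_abs_eval_expTaylor_le_exp_sqrt {l : ℕ} (hl : 1 ≤ l) {z : ℝ} (hz : 0 ≤ z) (K : ℕ)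
    (h : ((2 ^ K * l : ℕ) : ℝ) ≤ 16 * z) :
    ∏ j ∈ Finset.Icc 1 K, |(expTaylor (2 ^ j * l)).eval (-z)|
      ≤ Real.exp (7 * (√(16 * z) * √((2 ^ K * l : ℕ) : ℝ))) := by
  induction K with
  | zero => simpa using by positivity
  | succ K ih =>
    rw [Finset.prod_Icc_succ_top (by omega)]
    have e : √((2 ^ (K + 1) * l : ℕ) : ℝ) = √2 * √((2 ^ K * l : ℕ) : ℝ) := by
      rw [← Real.sqrt_mul (by norm_num)]
      push_cast
      ring_nf
    have h' : ((2 ^ K * l : ℕ) : ℝ) ≤ 16 * z := by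
      refine le_trans ?_ h
      gcongr <;> omega
    have hN : 1 ≤ 2 ^ (K + 1) * l := Nat.mul_pos (by positivity) hl
    have h1 := abs_eval_expTaylor_le_exp_sqrt hN hz h
    calc _ ≤ Real.exp (7 * (√(16 * z) * √((2 ^ K * l : ℕ) : ℝ)))
          * Real.exp (2 * (√(16 * z) * √((2 ^ (K + 1) * l : ℕ) : ℝ))) := by
          gcongr
          exact ih h'
      _ ≤ _ := by
          rw [← Real.exp_add, Real.exp_le_exp, e]
          -- The induction closes if `7 + 2√2 ≤ 7√2`, that is `7/5 ≤ √2`.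
          have h2 : (1.4 : ℝ) ≤ √2 := Real.le_sqrt_of_sq_le (by norm_num)
          have h3 : 0 ≤ √(16 * z) * √((2 ^ K * l : ℕ) : ℝ) := by positivity
          nlinarith

/-- Factors of degree at most `16 z` contribute together at most `exp (7 * 16 z)`. Each longer
factor exceeds `1` only by a truncation error, and these add at most `z` to the exponent: hence `113
= 112 + 1`, with `(1/2) ^ K` as the part of that budget still unspent. -/
theorem prod_abs_eval_expTaylor_le {l : ℕ} (hl : 1 ≤ l) {z : ℝ} (hz : 0 ≤ z) (K : ℕ) :
    ∏ j ∈ Finset.Icc 1 K, |(expTaylor (2 ^ j * l)).eval (-z)|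
      ≤ Real.exp ((113 - (1 / 2) ^ K) * z) := by
  induction K with
  | zero => simpa using by positivity
  | succ K ih =>
    rcases le_total ((2 ^ (K + 1) * l : ℕ) : ℝ) (16 * z) with h | h
    · refine (prod_abs_eval_expTaylor_le_exp_sqrt hl hz (K + 1) h).trans ?_
      rw [Real.exp_le_exp]
      have h1 : √((2 ^ (K + 1) * l : ℕ) : ℝ) ≤ √(16 * z) := Real.sqrt_le_sqrt h
      have h2 : √(16 * z) * √(16 * z) = 16 * z := Real.mul_self_sqrt (by positivity)
      have h3 : √(16 * z) * √((2 ^ (K + 1) * l : ℕ) : ℝ) ≤ 16 * z := by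
        exact (mul_le_mul_of_nonneg_left h1 (Real.sqrt_nonneg _)).trans h2.le
      have h4 : ((1 : ℝ) / 2) ^ (K + 1) ≤ 1 := pow_le_one₀ (by norm_num) (by norm_num)
      nlinarith
    · rw [Finset.prod_Icc_succ_top (by omega)]
      have h1 := abs_eval_expTaylor_le_exp_pow hz h
      have h2 : ((1 : ℝ) / 2) ^ (2 ^ (K + 1) * l) ≤ (1 / 2) ^ (K + 1) := by
        refine pow_le_pow_of_le_one (by norm_num) (by norm_num) ?_
        exact (Nat.lt_two_pow_self).le.trans (Nat.le_mul_of_pos_right _ hl)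
      calc _ ≤ Real.exp ((113 - (1 / 2) ^ K) * z)
            * Real.exp (z * (1 / 2) ^ (2 ^ (K + 1) * l)) := by gcongr
        _ ≤ _ := by
            rw [← Real.exp_add, Real.exp_le_exp]
            have h3 : z * (1 / 2) ^ (2 ^ (K + 1) * l) ≤ z * (1 / 2) ^ (K + 1) := by gcongr
            have h4 : ((1 : ℝ) / 2) ^ K = 2 * (1 / 2) ^ (K + 1) := by ring
            rw [h4]
            nlinarith

theorem abs_eval_iterTaylor_le {K l : ℕ} (hl : 1 ≤ l) {x : ℝ} (hx : x ≤ 0) :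
    |(iterTaylor K l).eval x| ≤ Real.exp (113 * (-x / K)) := by
  have hz : 0 ≤ -x / K := div_nonneg (by linarith) (by positivity)
  rw [iterTaylor, Polynomial.eval_prod, Finset.abs_prod]
  simp only [Polynomial.eval_comp, Polynomial.eval_mul, Polynomial.eval_C, Polynomial.eval_X]
  have e : 1 / (K : ℝ) * x = -(-x / K) := by ring
  rw [e]
  refine (prod_abs_eval_expTaylor_le hl hz K).trans (Real.exp_le_exp.2 ?_)
  have : (0 : ℝ) ≤ (1 / 2) ^ K := by positivity
  nlinarith

/-! ### Flatness of the integrated polynomial -/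

theorem abs_eval_iterTaylorInt_le_of_neg {K l : ℕ} (hl : 1 ≤ l) {x : ℝ} (hx : x ≤ 0) :
    |(iterTaylorInt K l).eval x| ≤ 1 + -x * Real.exp (113 * (-x / K)) := by
  rw [iterTaylorInt_eval]
  refine (abs_add_le _ _).trans ?_
  rw [abs_one]
  gcongr
  have h := intervalIntegral.norm_integral_le_of_norm_le_const (a := 0) (b := x)
    (f := fun y => (iterTaylor K l).eval y) (C := Real.exp (113 * (-x / K))) fun y hy => by
      rw [Set.uIoc_of_ge hx] at hy
      refine (abs_eval_iterTaylor_le hl hy.2).trans (Real.exp_le_exp.2 ?_)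
      have := hy.1
      gcongr
  rw [Real.norm_eq_abs, sub_zero, abs_of_nonpos hx] at h
  linarith

/-- This is the gain from integrating: where the integrand is nonnegative, the integral increases up
to its value `1` at `0`, so the bound holds with no error term near `0`. -/
theorem eval_iterTaylorInt_le_one {K l : ℕ} {x : ℝ} (hx : x ≤ 0)
    (h : ∀ y, x ≤ y → y ≤ 0 → 0 ≤ (iterTaylor K l).eval y) :
    (iterTaylorInt K l).eval x ≤ 1 := by
  rw [iterTaylorInt_eval, intervalIntegral.integral_symm]
  have := intervalIntegral.integral_nonneg (μ := MeasureTheory.volume) hx fun y hy => h y hy.1 hy.2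
  linarith

theorem exp_le_two_pow (n : ℕ) : Real.exp (n / 2) ≤ 2 ^ n := by
  have h : Real.exp (1 / 2) ≤ 2 := by
    have h1 : Real.exp (1 / 2) * Real.exp (1 / 2) = Real.exp 1 := by
      rw [← Real.exp_add]
      norm_num
    have h2 := Real.exp_one_lt_three
    by_contra! h3
    nlinarith
  calc Real.exp (n / 2) = Real.exp (1 / 2) ^ n := by
        rw [← Real.exp_nat_mul]
        ring_nf
    _ ≤ 2 ^ n := by gcongr

theorem half_pow_le_exp (n : ℕ) : (1 / 2 : ℝ) ^ n ≤ Real.exp (-(n / 2)) := by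
  rw [Real.exp_neg, one_div, inv_pow]
  exact inv_anti₀ (Real.exp_pos _) (exp_le_two_pow n)

/-- On the positive axis the coefficients are dominated by those of `exp`. On `[-l/10, 0]` the
truncation error `exp (-l)` is too small to make the integrand negative, so monotonicity applies.
Further left, the growth rate `113/K` of the integrand, plus `1/K` to absorb the length of the
interval, gives `114/K`. -/
theorem isFlatExpApprox_iterTaylorInt {K l : ℕ} (hK : 114 < K) (hl : 20 * K ^ 2 ≤ l)
    {ε : ℝ} (hε : 0 < ε) (hε1 : ε < 1) (hεl : Real.log (1 / ε) ≤ l) :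
    IsFlatExpApprox (iterTaylorInt K l) (l / 10) (114 / K) ε := by
  have hK0 : (114 : ℝ) < K := by exact_mod_cast hK
  have hl0 : (20 : ℝ) * K ^ 2 ≤ l := by exact_mod_cast hl
  have hl1 : (10 : ℝ) ≤ l := by nlinarith
  have hl2 : 1 ≤ l := by
    have : (1 : ℝ) ≤ l := by linarith
    exact_mod_cast this
  have hq := isExpTrunc_iterTaylorInt (by omega : 1 ≤ K) l
  have hp := isExpTrunc_iterTaylor (by omega : 1 ≤ K) l
  have hqx : ∀ x : ℝ, |x| ≤ l / 10 →
      |(iterTaylorInt K l).eval x - Real.exp x| ≤ Real.exp (-l) := fun x hx => by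
    refine (hq.abs_eval_sub_exp_le x).trans
      ((pow_div_factorial_mul_exp_le (abs_nonneg x) (by push_cast; linarith)).trans
        ((half_pow_le_exp _).trans (Real.exp_le_exp.2 (by push_cast; linarith))))
  have hpx : ∀ x : ℝ, |x| ≤ l / 10 →
      |(iterTaylor K l).eval x - Real.exp x| ≤ Real.exp (-l) := fun x hx => by
    refine (hp.abs_eval_sub_exp_le x).trans
      ((pow_div_factorial_mul_exp_le (abs_nonneg x) (by push_cast; linarith)).trans
        ((half_pow_le_exp _).trans (Real.exp_le_exp.2 (by push_cast; linarith))))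
  refine ⟨⟨hε, hε1⟩, ⟨by positivity, (div_lt_one (by linarith)).2 hK0⟩, by linarith,
    fun x hx => (hqx x (abs_le.2 hx)).trans ?_, fun x => ?_⟩
  · rw [one_div, Real.log_inv] at hεl
    calc Real.exp (-l) ≤ Real.exp (Real.log ε) := Real.exp_le_exp.2 (by linarith)
      _ = ε := Real.exp_log hε
  · have h1 : 1 ≤ Real.exp (114 / K * |x|) := Real.one_le_exp (by positivity)
    rcases le_total 0 x with hx | hx
    · rw [abs_of_nonneg (hq.eval_nonneg hx)]
      calc _ ≤ Real.exp x * 1 := by simpa using hq.eval_le_exp hx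
        _ ≤ _ := by
          gcongr
          exact le_max_right _ _
    · suffices |(iterTaylorInt K l).eval x| ≤ Real.exp (114 / K * |x|) by
        calc _ ≤ 1 * Real.exp (114 / K * |x|) := by simpa using this
          _ ≤ _ := by
            gcongr
            exact le_max_left _ _
      rcases le_total |x| (l / 10) with h | h
      · refine le_trans (abs_le.2 ⟨?_, ?_⟩) h1
        · have := (abs_le.1 (hqx x h)).1
          have h3 : Real.exp (-(l : ℝ)) ≤ 1 := Real.exp_le_one_iff.2 (by linarith)
          linarith [Real.exp_pos x]
        · refine eval_iterTaylorInt_le_one hx fun y hxy hy => ?_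
          rw [abs_of_nonpos hx] at h
          have := (abs_le.1 (hpx y (by rw [abs_of_nonpos hy]; linarith))).1
          have h3 : Real.exp (-(l : ℝ)) ≤ Real.exp y := Real.exp_le_exp.2 (by linarith)
          linarith
      · refine (abs_eval_iterTaylorInt_le_of_neg hl2 hx).trans ?_
        rw [abs_of_nonpos hx] at h ⊢
        set y := -x
        have hy0 : 0 ≤ y := by linarith
        have hK1 : (0 : ℝ) < K := by linarith
        have h2 : 1 + y ≤ Real.exp (y / K) := by
          refine le_trans ?_ (Real.quadratic_le_exp_of_nonneg (by positivity))
          -- This needs `y ≥ 2 K ^ 2`, which is what `l ≥ 20 K ^ 2` and `y ≥ l / 10` provide.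
          have h3 : y ≤ (y / K) ^ 2 / 2 := by
            rw [div_pow, div_div, le_div_iff₀ (by positivity)]
            nlinarith
          have : 0 ≤ y / K := by positivity
          linarith
        have h3 : 1 ≤ Real.exp (113 * (y / K)) := Real.one_le_exp (by positivity)
        calc 1 + y * Real.exp (113 * (y / K)) ≤ (1 + y) * Real.exp (113 * (y / K)) := by
              nlinarith
          _ ≤ Real.exp (y / K) * Real.exp (113 * (y / K)) := by gcongr
          _ = _ := by
              rw [← Real.exp_add]
              congr 1
              ring

/-! ### Products of Pauli operators -/

/-- The tensor product of the matrices `M i`. -/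
noncomputable def tensorOp {n : ℕ} (M : Fin n → Matrix (Fin 2) (Fin 2) ℂ) : Op n :=
  Matrix.of fun x y => ∏ i, M i (x i) (y i)

theorem tensorOp_mul {n : ℕ} (M N : Fin n → Matrix (Fin 2) (Fin 2) ℂ) :
    tensorOp M * tensorOp N = tensorOp fun i => M i * N i := by
  ext x y
  simp only [tensorOp, Matrix.mul_apply, Matrix.of_apply, ← Finset.prod_mul_distrib]
  rw [Finset.prod_univ_sum, Fintype.piFinset_univ]

theorem tensorOp_one (n : ℕ) : tensorOp (n := n) (fun _ => 1) = 1 := by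
  ext x y
  simp only [tensorOp, Matrix.of_apply, Matrix.one_apply, funext_iff]
  split_ifs with h
  · simp [h]
  · push Not at h
    obtain ⟨i, hi⟩ := h
    exact Finset.prod_eq_zero (Finset.mem_univ i) (by simp [hi])

theorem tensorOp_smul {n : ℕ} (c : Fin n → ℂ) (M : Fin n → Matrix (Fin 2) (Fin 2) ℂ) :
    tensorOp (fun i => c i • M i) = (∏ i, c i) • tensorOp M := by
  ext x y
  simp [tensorOp, Finset.prod_mul_distrib]

theorem PauliString.op_eq {n : ℕ} (P : PauliString n) : P.op = tensorOp fun i => sigma (P i) := rfl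

theorem sigma_zero : sigma 0 = 1 := rfl

theorem sigma_mul (p q : Fin 4) : ∃ (c : ℂ) (r : Fin 4), ‖c‖ = 1 ∧
    sigma p * sigma q = c • sigma r ∧ (p = 0 → q = 0 → r = 0) := by
  -- The multiplication table of the Pauli matrices, as phases and then as indices.
  refine ⟨![![1, 1, 1, 1], ![1, 1, Complex.I, -Complex.I], ![1, -Complex.I, 1, Complex.I],
    ![1, Complex.I, -Complex.I, 1]] p q,
    ![![0, 1, 2, 3], ![1, 0, 3, 2], ![2, 3, 0, 1], ![3, 2, 1, 0]] p q, ?_, ?_, ?_⟩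
  · fin_cases p <;> fin_cases q <;> simp
  · fin_cases p <;> fin_cases q <;> ext i j <;> fin_cases i <;> fin_cases j <;>
      simp [sigma, Matrix.mul_apply, Fin.sum_univ_two]
  · rintro rfl rfl
    rfl

theorem sigma_mul_self (p : Fin 4) : sigma p * sigma p = 1 := by
  fin_cases p <;> ext i j <;> fin_cases i <;> fin_cases j <;>
    simp [sigma, Matrix.mul_apply, Fin.sum_univ_two]

theorem sigma_star (p : Fin 4) (i j : Fin 2) : star (sigma p i j) = sigma p j i := by
  fin_cases p <;> fin_cases i <;> fin_cases j <;> simp [sigma]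

theorem PauliString.op_mul {n : ℕ} (P Q : PauliString n) : ∃ (c : ℂ) (R : PauliString n),
    ‖c‖ = 1 ∧ P.op * Q.op = c • R.op ∧ R.supp ⊆ P.supp ∪ Q.supp := by
  choose c r hc hr h0 using fun i => sigma_mul (P i) (Q i)
  refine ⟨∏ i, c i, r, by simp [norm_prod, hc], ?_, fun i hi => ?_⟩
  · rw [op_eq, op_eq, op_eq, tensorOp_mul, ← tensorOp_smul]
    simp only [hr]
  · simp only [supp, Finset.mem_union, Finset.mem_filter, Finset.mem_univ, true_and] at hi ⊢
    by_contra! h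
    exact hi (h0 i h.1 h.2)

theorem PauliString.op_mul_self {n : ℕ} (P : PauliString n) : P.op * P.op = 1 := by
  rw [op_eq, tensorOp_mul]
  simp only [sigma_mul_self, tensorOp_one]

theorem PauliString.op_zero {n : ℕ} : PauliString.op (0 : PauliString n) = 1 := by
  rw [op_eq, ← tensorOp_one]
  rfl

theorem PauliString.supp_zero {n : ℕ} : PauliString.supp (0 : PauliString n) = ∅ := by
  simp [supp]

theorem PauliString.op_isHermitian {n : ℕ} (P : PauliString n) : P.op.IsHermitian := by
  ext x y
  rw [Matrix.conjTranspose_apply]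
  simp only [op, Matrix.of_apply, star_prod, sigma_star]

theorem PauliString.op_comm {n : ℕ} {P Q : PauliString n} (h : Disjoint P.supp Q.supp) :
    P.op * Q.op = Q.op * P.op := by
  rw [op_eq, op_eq, tensorOp_mul, tensorOp_mul]
  congr 1
  funext i
  by_cases hP : P i = 0
  · simp [hP, sigma_zero]
  · have hi : i ∈ P.supp := by simp [supp, hP]
    have hQ : Q i = 0 := by simpa [supp] using Finset.disjoint_left.1 h hi
    simp [hQ, sigma_zero]

/-! ### The operator norm -/

/-- The operator norm as a seminorm. -/
noncomputable def opSeminorm (n : ℕ) : Seminorm ℂ (Op n) :=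
  Seminorm.of opNorm (fun A B => by simpa only [opNorm, map_add] using norm_add_le _ _)
    fun c A => by simp only [opNorm, map_smul, norm_smul]

theorem opSeminorm_apply {n : ℕ} (A : Op n) : opSeminorm n A = opNorm A := rfl

theorem sum_norm_sq_mulVec_le {n : ℕ} (A : Op n) (x : (Fin n → Fin 2) → ℂ) :
    ∑ i, ‖(A *ᵥ x) i‖ ^ 2 ≤ opNorm A ^ 2 * ∑ i, ‖x i‖ ^ 2 := by
  have h := (Matrix.toEuclideanCLM (𝕜 := ℂ) A).le_opNorm (WithLp.toLp 2 x)
  rw [Matrix.toEuclideanCLM_toLp] at h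
  have h2 := pow_le_pow_left₀ (norm_nonneg _) h 2
  rw [mul_pow, EuclideanSpace.norm_sq_eq, EuclideanSpace.norm_sq_eq] at h2
  exact h2

theorem PauliString.opNorm_op {n : ℕ} (P : PauliString n) : opNorm P.op = 1 := by
  have h := CStarRing.norm_star_mul_self (x := Matrix.toEuclideanCLM (𝕜 := ℂ) P.op)
  rw [← map_star, ← map_mul, Matrix.star_eq_conjTranspose, P.op_isHermitian, op_mul_self, map_one,
    norm_one] at h
  have h0 : 0 ≤ opNorm P.op := norm_nonneg _
  change 1 = opNorm P.op * opNorm P.op at h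
  nlinarith

/-! ### Linear combinations of Pauli operators with bounded weight -/

/-- `X` is a linear combination of Pauli operators in `Q` whose coefficients have absolute values
with sum at most `w`. -/
inductive PauliSum {n : ℕ} (Q : Set (PauliString n)) : ℝ → Op n → Prop
  | smul_op (c : ℂ) (P : PauliString n) (hP : P ∈ Q) : PauliSum Q ‖c‖ (c • P.op)
  | zero : PauliSum Q 0 0
  | add {w v : ℝ} {X Y : Op n} (hX : PauliSum Q w X) (hY : PauliSum Q v Y) :
      PauliSum Q (w + v) (X + Y)
  | mono {w v : ℝ} {X : Op n} (hX : PauliSum Q w X) (h : w ≤ v) : PauliSum Q v X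

namespace PauliSum

variable {n : ℕ} {Q : Set (PauliString n)}

theorem of_mem {P : PauliString n} (hP : P ∈ Q) : PauliSum Q 1 P.op := by
  simpa using smul_op 1 P hP

theorem smul {w : ℝ} {X : Op n} (hX : PauliSum Q w X) (c : ℂ) :
    PauliSum Q (‖c‖ * w) (c • X) := by
  induction hX with
  | smul_op c' P hP => simpa [smul_smul] using smul_op (c * c') P hP
  | zero => simpa using zero (Q := Q)
  | add _ _ h1 h2 => simpa [mul_add] using h1.add h2
  | mono _ h h1 => exact h1.mono (by gcongr)

theorem sum {ι : Type*} (s : Finset ι) {w : ι → ℝ} {X : ι → Op n}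
    (h : ∀ i ∈ s, PauliSum Q (w i) (X i)) : PauliSum Q (∑ i ∈ s, w i) (∑ i ∈ s, X i) := by
  classical
  induction s using Finset.induction_on with
  | empty => simpa using zero (Q := Q)
  | insert a s ha ih =>
    rw [Finset.sum_insert ha, Finset.sum_insert ha]
    exact (h a (by simp)).add (ih fun i hi => h i (by simp [hi]))

/-- Stated for an arbitrary seminorm because it serves twice: for the operator norm, and for the
error of the trace estimates. -/
theorem seminorm_le {w : ℝ} {X : Op n} (hX : PauliSum Q w X) (N : Seminorm ℂ (Op n)) {δ : ℝ}
    (hδ : 0 ≤ δ) (h : ∀ P ∈ Q, N P.op ≤ δ) : N X ≤ w * δ := by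
  induction hX with
  | smul_op c' P hP =>
    rw [map_smul_eq_mul]
    gcongr
    exact h P hP
  | zero => simp
  | add _ _ h1 h2 => exact (map_add_le_add N _ _).trans (by linarith)
  | mono _ h h1 => exact h1.trans (by gcongr)

theorem opNorm_le {w : ℝ} {X : Op n} (hX : PauliSum Q w X) : opNorm X ≤ w := by
  simpa [opSeminorm_apply] using hX.seminorm_le (opSeminorm n) zero_le_one fun P _ =>
    (opSeminorm_apply P.op).trans_le P.opNorm_op.le

end PauliSum

/-! ### Nested commutators with a local Hamiltonian -/

/-- The Paulis supported on at most `s` connected terms. -/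
def coveredBy {n m : ℕ} (E : Fin m → PauliString n) (s : ℕ) : Set (PauliString n) :=
  {P | ∃ S : Finset (Fin m), ((dualGraph E).induce (S : Set (Fin m))).Connected ∧
    S.card ≤ s ∧ P.supp ⊆ S.biUnion fun a => (E a).supp}

theorem coveredBy_subset_graphLocal {n m : ℕ} (E : Fin m → PauliString n) {k s r : ℕ}
    (h : k * s ≤ r) : coveredBy E s ⊆ graphLocal E k r := fun _ ⟨S, h1, h2, h3⟩ =>
  ⟨S, h1, (Nat.mul_le_mul_left k h2).trans h, h3⟩

theorem zero_mem_coveredBy {n m : ℕ} (E : Fin m → PauliString n) (hm : 0 < m) {s : ℕ}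
    (hs : 1 ≤ s) : (0 : PauliString n) ∈ coveredBy E s := by
  refine ⟨{⟨0, hm⟩}, ?_, by simpa using hs, by simp [PauliString.supp_zero]⟩
  rw [Finset.coe_singleton]
  exact SimpleGraph.Connected.mk (SimpleGraph.Preconnected.of_subsingleton)

theorem term_mem_coveredBy {n m : ℕ} (E : Fin m → PauliString n) (a : Fin m) {s : ℕ}
    (hs : 1 ≤ s) : E a ∈ coveredBy E s := by
  refine ⟨{a}, ?_, by simpa using hs, by simp⟩
  rw [Finset.coe_singleton]
  exact SimpleGraph.Connected.mk (SimpleGraph.Preconnected.of_subsingleton)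

namespace LocalHamiltonian

theorem locality_pos {n m k d : ℕ} (H : LocalHamiltonian n m k d) (a : Fin m) : 0 < k := by
  refine lt_of_lt_of_le (Finset.card_pos.2 ?_) (H.card_supp_le a)
  obtain ⟨i, hi⟩ := Function.ne_iff.1 (H.term_ne_one a)
  exact ⟨i, by simpa [PauliString.supp] using hi⟩

variable {n m k d : ℕ} (H : LocalHamiltonian n m k d)

/-- Cancelling `k` is legitimate because a connected set contains a term, and a non-identity term
has nonempty support. -/
theorem graphLocal_subset_coveredBy (s : ℕ) : graphLocal H.term k (k * s) ⊆ coveredBy H.term s := by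
  rintro P ⟨S, h1, h2, h3⟩
  obtain ⟨a⟩ := h1.nonempty
  exact ⟨S, h1, Nat.le_of_mul_le_mul_left h2 (H.locality_pos a.1), h3⟩

/-- The terms whose support meets that of one of the terms in `S`. -/
noncomputable def touching (S : Finset (Fin m)) : Finset (Fin m) :=
  Finset.univ.filter fun a => ¬ Disjoint (H.term a).supp (S.biUnion fun b => (H.term b).supp)

theorem mem_touching {S : Finset (Fin m)} {a : Fin m} (h : a ∈ H.touching S) :
    ∃ b ∈ S, a = b ∨ (dualGraph H.term).Adj b a := by
  rw [touching, Finset.mem_filter, Finset.not_disjoint_iff] at h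
  obtain ⟨-, i, hi, hi'⟩ := h
  obtain ⟨b, hb, hib⟩ := Finset.mem_biUnion.1 hi'
  refine ⟨b, hb, ?_⟩
  by_cases hab : a = b
  · exact Or.inl hab
  · exact Or.inr ⟨Ne.symm hab, i, Finset.mem_inter.2 ⟨hib, hi⟩⟩

theorem card_touching_le (S : Finset (Fin m)) : (H.touching S).card ≤ S.card * (d + 1) := by
  classical
  have h1 : H.touching S ⊆
      S.biUnion fun b => insert b ((dualGraph H.term).neighborSet b).toFinset := by
    intro a ha
    obtain ⟨b, hb, h⟩ := H.mem_touching ha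
    exact Finset.mem_biUnion.2 ⟨b, hb, by simpa using h⟩
  refine (Finset.card_le_card h1).trans (Finset.card_biUnion_le_card_mul _ _ _ fun b _ => ?_)
  refine (Finset.card_insert_le _ _).trans (Nat.succ_le_succ ?_)
  rw [← Set.ncard_eq_toFinset_card']
  exact H.degree_le b

theorem insert_connected {S : Finset (Fin m)}
    (hS : ((dualGraph H.term).induce (S : Set (Fin m))).Connected) {a : Fin m}
    (ha : a ∈ H.touching S) :
    ((dualGraph H.term).induce ((insert a S : Finset (Fin m)) : Set (Fin m))).Connected := by
  obtain ⟨b, hb, rfl | h⟩ := H.mem_touching ha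
  · rwa [Finset.insert_eq_of_mem hb]
  · have := SimpleGraph.induce_union_connected hS.preconnected
      (SimpleGraph.induce_pair_connected_of_adj h).preconnected ⟨b, by simpa using hb⟩
    have e : ((insert a S : Finset (Fin m)) : Set (Fin m)) = (S : Set (Fin m)) ∪ {b, a} := by
      ext x
      simp only [Finset.coe_insert, Set.mem_insert_iff, Finset.mem_coe, Set.mem_union,
        Set.mem_singleton_iff]
      constructor
      · rintro (h | h) <;> simp [h]
      · rintro (h | h | h)
        · exact Or.inr h
        · exact Or.inr (h ▸ hb)
        · exact Or.inl h
    rw [e]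
    exact this

theorem pauliSum_commutator_term {S : Finset (Fin m)}
    (hS : ((dualGraph H.term).induce (S : Set (Fin m))).Connected) {s : ℕ} (hs : S.card ≤ s)
    {P : PauliString n} (hP : P.supp ⊆ S.biUnion fun a => (H.term a).supp) {a : Fin m}
    (ha : a ∈ H.touching S) :
    PauliSum (coveredBy H.term (s + 1)) 2
      ((H.coeff a : ℂ) • ((H.term a).op * P.op - P.op * (H.term a).op)) := by
  have key : ∀ R : PauliString n, R.supp ⊆ (H.term a).supp ∪ P.supp →
      R ∈ coveredBy H.term (s + 1) := fun R hR =>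
    ⟨insert a S, H.insert_connected hS ha, (Finset.card_insert_le _ _).trans (by omega), by
      rw [Finset.biUnion_insert]
      exact hR.trans (Finset.union_subset_union_right hP)⟩
  obtain ⟨c, R, hc, e, hR⟩ := (H.term a).op_mul P
  obtain ⟨c', R', hc', e', hR'⟩ := P.op_mul (H.term a)
  rw [Finset.union_comm] at hR'
  have h := (PauliSum.smul_op c R (key R hR)).add (PauliSum.smul_op (-c') R' (key R' hR'))
  have h2 := (h.smul (H.coeff a : ℂ)).mono (v := 2) (by
    rw [norm_neg, hc, hc', Complex.norm_real, Real.norm_eq_abs]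
    linarith [H.abs_coeff_le a])
  rw [e, e']
  simpa [sub_eq_add_neg] using h2

/-- A Pauli on `s` connected terms commutes with every term it does not touch. At most `s(d+1)`
terms remain; each commutator is two Paulis with phases, supported on the set enlarged by one
adjacent term. -/
theorem pauliSum_commutator {s : ℕ} {w : ℝ} {X : Op n}
    (hX : PauliSum (coveredBy H.term s) w X) :
    PauliSum (coveredBy H.term (s + 1)) (2 * (s * (d + 1)) * w) (H.op * X - X * H.op) := by
  induction hX with
  | smul_op c P hP =>
    obtain ⟨S, hS, hs, hP⟩ := hP
    have h := PauliSum.sum (H.touching S) fun a ha => H.pauliSum_commutator_term hS hs hP ha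
    have e : H.op * c • P.op - c • P.op * H.op = c • ∑ a ∈ H.touching S,
        (H.coeff a : ℂ) • ((H.term a).op * P.op - P.op * (H.term a).op) := by
      rw [Finset.sum_subset (Finset.subset_univ _)]
      · rw [mul_smul_comm, smul_mul_assoc, ← smul_sub, LocalHamiltonian.op, hamOp, Finset.sum_mul,
          Finset.mul_sum, ← Finset.sum_sub_distrib]
        simp only [smul_sub, smul_mul_assoc, mul_smul_comm]
      · intro a _ ha
        rw [touching, Finset.mem_filter, not_and, not_not] at ha
        have hd := (ha (Finset.mem_univ a)).mono_right hP
        rw [PauliString.op_comm hd, sub_self, smul_zero]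
    rw [e]
    refine (h.smul c).mono ?_
    rw [mul_comm _ ‖c‖]
    gcongr
    rw [Finset.sum_const, nsmul_eq_mul, mul_comm]
    gcongr
    calc ((H.touching S).card : ℝ) ≤ ((S.card * (d + 1) : ℕ) : ℝ) := by
          exact_mod_cast H.card_touching_le S
      _ ≤ s * (d + 1) := by
          push_cast
          gcongr
  | zero => simpa using PauliSum.zero
  | @add w v X Y _ _ h1 h2 =>
    have := h1.add h2
    convert this using 1
    · ring
    · noncomm_ring
  | mono _ h h1 => exact h1.mono (by gcongr)

/-- The weights multiply to `∏ 2(4 + j)(d + 1)`, and `4 + j ≤ 4(j + 1)` turns this into a factorial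
times a power. Starting from `4` terms covers the `4k`-local Paulis of the system. -/
theorem pauliSum_nestedComm {A : PauliString n} (hA : A ∈ coveredBy H.term 4) (i : ℕ) :
    PauliSum (coveredBy H.term (4 + i)) (i.factorial * (8 * (d + 1)) ^ i)
      (nestedComm H.op A.op i) := by
  induction i with
  | zero => simpa [nestedComm] using PauliSum.of_mem hA
  | succ i ih =>
    refine (H.pauliSum_commutator ih).mono ?_
    rw [Nat.factorial_succ]
    push_cast
    have h : 2 * ((4 + (i : ℝ)) * (d + 1)) ≤ (i + 1) * (8 * (d + 1)) := by
      have : (0 : ℝ) ≤ i * d := by positivity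
      have : (0 : ℝ) ≤ i := by positivity
      nlinarith
    calc _ ≤ ((i + 1) * (8 * ((d : ℝ) + 1))) * (i.factorial * (8 * (d + 1)) ^ i) := by gcongr
      _ = _ := by ring

theorem op_isHermitian : H.op.IsHermitian := by
  rw [Matrix.IsHermitian, op, hamOp, Matrix.conjTranspose_sum]
  refine Finset.sum_congr rfl fun a _ => ?_
  rw [Matrix.conjTranspose_smul, (H.term a).op_isHermitian]
  simp

end LocalHamiltonian

/-! ### Commutator polynomials in an eigenbasis -/

theorem nestedComm_smul {n : ℕ} (c : ℂ) (X A : Op n) (i : ℕ) :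
    nestedComm (c • X) A i = c ^ i • nestedComm X A i := by
  induction i with
  | zero => simp [nestedComm]
  | succ i ih =>
    rw [nestedComm, nestedComm, ih, smul_mul_smul_comm, smul_mul_smul_comm, smul_sub, pow_succ,
      mul_comm c]

theorem seminorm_commPoly_le {n : ℕ} (N : Seminorm ℂ (Op n)) (p : ℝ[X]) (r : ℝ) (X A : Op n) :
    N (commPoly p ((r : ℂ) • X) A)
      ≤ ∑ i ∈ p.support, |p.coeff i| * |r| ^ i * N (nestedComm X A i) := by
  rw [commPoly, Polynomial.sum]
  refine (Finset.le_sum_of_subadditive N (map_zero N).le (map_add_le_add N) _ _).trans (Finset.sum_le_sum fun i _ => ?_)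
  rw [nestedComm_smul, map_smul_eq_mul, map_smul_eq_mul, norm_pow, Complex.norm_real,
    Complex.norm_real, Real.norm_eq_abs, Real.norm_eq_abs, mul_assoc]

/-- The matrix of `X` in the orthonormal basis given by the columns of `U`. -/
noncomputable def basisConj {n : ℕ} (U X : Op n) : Op n := Uᴴ * X * U

section BasisConj

variable {n : ℕ} {U : Op n}

theorem basisConj_mul (hU : U * Uᴴ = 1) (X Y : Op n) :
    basisConj U (X * Y) = basisConj U X * basisConj U Y := by
  calc Uᴴ * (X * Y) * U = Uᴴ * X * 1 * Y * U := by simp only [mul_one, mul_assoc]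
    _ = Uᴴ * X * (U * Uᴴ) * Y * U := by rw [hU]
    _ = _ := by simp only [basisConj, mul_assoc]

theorem basisConj_sub (X Y : Op n) : basisConj U (X - Y) = basisConj U X - basisConj U Y := by
  simp [basisConj, mul_sub, sub_mul]

theorem basisConj_smul (c : ℂ) (X : Op n) : basisConj U (c • X) = c • basisConj U X := by
  simp [basisConj]

theorem basisConj_sum {ι : Type*} (s : Finset ι) (X : ι → Op n) :
    basisConj U (∑ i ∈ s, X i) = ∑ i ∈ s, basisConj U (X i) := by
  simp [basisConj, Finset.mul_sum, Finset.sum_mul]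

theorem trace_basisConj (hU : U * Uᴴ = 1) (X : Op n) :
    (basisConj U X).trace = X.trace := by
  rw [basisConj, Matrix.trace_mul_comm, ← mul_assoc, hU, one_mul]

theorem basisConj_isHermitian {X : Op n} (hX : X.IsHermitian) : (basisConj U X).IsHermitian :=
  Matrix.isHermitian_conjTranspose_mul_mul U hX

theorem basisConj_exp (hU : U * Uᴴ = 1) (X : Op n) :
    basisConj U (NormedSpace.exp X) = NormedSpace.exp (basisConj U X) := by
  have h : U⁻¹ = Uᴴ := Matrix.inv_eq_right_inv hU
  have hu : IsUnit U := ⟨⟨U, Uᴴ, hU, mul_eq_one_comm.1 hU⟩, rfl⟩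
  rw [basisConj, basisConj, ← h, Matrix.exp_conj' _ _ hu]

theorem opNorm_le_one_of_conjTranspose_mul_self {V : Op n} (hV : Vᴴ * V = 1) : opNorm V ≤ 1 := by
  have h := CStarRing.norm_star_mul_self (x := Matrix.toEuclideanCLM (𝕜 := ℂ) V)
  rw [← map_star, ← map_mul, Matrix.star_eq_conjTranspose, hV, map_one, norm_one] at h
  have h0 : 0 ≤ opNorm V := norm_nonneg _
  change 1 = opNorm V * opNorm V at h
  nlinarith

theorem opNorm_mul_le (X Y : Op n) : opNorm (X * Y) ≤ opNorm X * opNorm Y := by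
  simpa only [opNorm, map_mul] using norm_mul_le _ _

theorem opNorm_basisConj_le (hU : U * Uᴴ = 1) (X : Op n) : opNorm (basisConj U X) ≤ opNorm X := by
  have h1 : opNorm U ≤ 1 := opNorm_le_one_of_conjTranspose_mul_self (mul_eq_one_comm.1 hU)
  have h2 : opNorm Uᴴ ≤ 1 := opNorm_le_one_of_conjTranspose_mul_self (by simpa using hU)
  have h0 : ∀ Y : Op n, 0 ≤ opNorm Y := fun Y => norm_nonneg _
  calc opNorm (basisConj U X) ≤ opNorm Uᴴ * opNorm X * opNorm U :=
        (opNorm_mul_le _ _).trans (mul_le_mul_of_nonneg_right (opNorm_mul_le _ _) (h0 U))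
    _ ≤ 1 * opNorm X * 1 := by
        have := h0 X
        gcongr
        exact h0 U
    _ = _ := by ring

theorem sum_norm_sq_col_le (X : Op n) (j : Fin n → Fin 2) :
    ∑ i, ‖X i j‖ ^ 2 ≤ opNorm X ^ 2 := by
  have h := sum_norm_sq_mulVec_le X (Pi.single j 1)
  have e : ∑ i, ‖(Pi.single j 1 : (Fin n → Fin 2) → ℂ) i‖ ^ 2 = 1 := by
    rw [Finset.sum_eq_single j] <;> simp +contextual
  rw [e, mul_one] at h
  simpa using h

variable {H : Op n} {h : (Fin n → Fin 2) → ℝ}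

theorem basisConj_nestedComm_apply (hU : U * Uᴴ = 1)
    (hH : basisConj U H = Matrix.diagonal fun i => (h i : ℂ)) (A : Op n) (k : ℕ)
    (i j : Fin n → Fin 2) :
    basisConj U (nestedComm H A k) i j = ((h i : ℂ) - h j) ^ k * basisConj U A i j := by
  induction k with
  | zero => simp [nestedComm]
  | succ k ih =>
    rw [nestedComm, basisConj_sub, basisConj_mul hU, basisConj_mul hU, hH, Matrix.sub_apply,
      Matrix.diagonal_mul, Matrix.mul_diagonal, ih]
    ring

theorem basisConj_commPoly_apply (hU : U * Uᴴ = 1)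
    (hH : basisConj U H = Matrix.diagonal fun i => (h i : ℂ)) (p : ℝ[X]) (r : ℝ) (A : Op n)
    (i j : Fin n → Fin 2) :
    basisConj U (commPoly p ((r : ℂ) • H) A) i j
      = ((p.eval (r * (h i - h j)) : ℝ) : ℂ) * basisConj U A i j := by
  rw [commPoly, Polynomial.sum, basisConj_sum, Matrix.sum_apply, Polynomial.eval_eq_sum,
    Polynomial.sum, Complex.ofReal_sum, Finset.sum_mul]
  refine Finset.sum_congr rfl fun k _ => ?_
  rw [nestedComm_smul, basisConj_smul, basisConj_smul, Matrix.smul_apply, Matrix.smul_apply,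
    basisConj_nestedComm_apply hU hH]
  simp only [smul_eq_mul]
  push_cast
  rw [mul_pow]
  ring

/-- The eigenvalues of the Gibbs state. -/
noncomputable def gibbsWeight {n : ℕ} (β : ℝ) (h : (Fin n → Fin 2) → ℝ) (i : Fin n → Fin 2) : ℝ :=
  (∑ j, Real.exp (-β * h j))⁻¹ * Real.exp (-β * h i)

theorem gibbsWeight_nonneg (β : ℝ) (h : (Fin n → Fin 2) → ℝ) (i : Fin n → Fin 2) :
    0 ≤ gibbsWeight β h i := by
  unfold gibbsWeight
  positivity

theorem sum_gibbsWeight (β : ℝ) (h : (Fin n → Fin 2) → ℝ) : ∑ i, gibbsWeight β h i = 1 := by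
  simp only [gibbsWeight]
  rw [← Finset.mul_sum, inv_mul_cancel₀]
  exact (Finset.sum_pos (fun i _ => Real.exp_pos _) Finset.univ_nonempty).ne'

theorem exp_mul_gibbsWeight (β : ℝ) (h : (Fin n → Fin 2) → ℝ) (i j : Fin n → Fin 2) :
    Real.exp (-β * (h i - h j)) * gibbsWeight β h j = gibbsWeight β h i := by
  rw [gibbsWeight, gibbsWeight, mul_left_comm, ← Real.exp_add]
  ring_nf

theorem basisConj_gibbs (hU : U * Uᴴ = 1)
    (hH : basisConj U H = Matrix.diagonal fun i => (h i : ℂ)) (β : ℝ) :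
    basisConj U (gibbs β H) = Matrix.diagonal fun i => (gibbsWeight β h i : ℂ) := by
  have e : basisConj U (NormedSpace.exp (-(β : ℂ) • H))
      = Matrix.diagonal fun i => ((Real.exp (-β * h i) : ℝ) : ℂ) := by
    rw [basisConj_exp hU, basisConj_smul, hH, ← Matrix.diagonal_smul, Matrix.exp_diagonal]
    congr 1
    funext i
    rw [Pi.coe_exp]
    simp [← Complex.exp_eq_exp_ℂ]
  rw [gibbs, basisConj_smul, ← trace_basisConj hU, e, Matrix.trace_diagonal, ← Matrix.diagonal_smul]
  congr 1
  funext i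
  simp [gibbsWeight]

theorem gibbs_commute (β : ℝ) (H : Op n) : Commute (gibbs β H) H := by
  have : Commute (-(β : ℂ) • H) H := (Commute.refl H).smul_left _
  exact (Commute.smul_left (this.exp_left) _)

end BasisConj

theorem exists_diagonalizing_basis {n : ℕ} {H : Op n} (hH : H.IsHermitian) :
    ∃ (U : Op n) (h : (Fin n → Fin 2) → ℝ), U * Uᴴ = 1 ∧
      basisConj U H = Matrix.diagonal fun i => (h i : ℂ) := by
  refine ⟨hH.eigenvectorUnitary, hH.eigenvalues,
    Unitary.coe_mul_star_self hH.eigenvectorUnitary, ?_⟩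
  have h := hH.conjStarAlgAut_star_eigenvectorUnitary
  rw [Unitary.conjStarAlgAut_apply] at h
  simpa [basisConj, Matrix.star_eq_conjTranspose, Function.comp_def] using h

/-! ### Flat approximations applied to quasi-local operators -/

theorem tendsto_eval_expTaylor (x : ℝ) :
    Filter.Tendsto (fun N => (expTaylor N).eval x) Filter.atTop (nhds (Real.exp x)) := by
  have h := ((hasSum_pow_div_factorial x).tendsto_sum_nat).comp (Filter.tendsto_add_atTop_nat 1)
  refine h.congr fun N => ?_
  simp [expTaylor, Polynomial.eval_finsetSum, div_eq_inv_mul]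

/-- These are the truncations of `exp(tH) A exp(-tH)`. The factorials cancel and a geometric series
of ratio `1/3` remains. -/
theorem opNorm_commPoly_expTaylor_le {n : ℕ} {H A : Op n} {G t : ℝ}
    (hG : ∀ i, opNorm (nestedComm H A i) ≤ i.factorial * G ^ i) (ht : |t| * G = 1 / 3) (N : ℕ) :
    opNorm (commPoly (expTaylor N) ((t : ℂ) • H) A) ≤ 3 / 2 := by
  have h := seminorm_commPoly_le (opSeminorm n) (expTaylor N) t H A
  rw [opSeminorm_apply] at h
  refine h.trans ?_
  have hs : HasSum (fun i : ℕ => (1 / 3 : ℝ) ^ i) (3 / 2) := by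
    have := hasSum_geometric_of_lt_one (r := (1 / 3 : ℝ)) (by norm_num) (by norm_num)
    convert this using 1
    norm_num
  refine le_trans (Finset.sum_le_sum fun i _ => ?_)
    (sum_le_hasSum (expTaylor N).support (fun i _ => by positivity) hs)
  obtain ⟨h0, h1, -⟩ := isExpTrunc_expTaylor N i
  rw [opSeminorm_apply, abs_of_nonneg h0, ← ht, mul_pow]
  have hf : (0 : ℝ) < i.factorial := by positivity
  have h2 : 0 ≤ opNorm (nestedComm H A i) := norm_nonneg _
  calc (expTaylor N).coeff i * |t| ^ i * opNorm (nestedComm H A i)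
      ≤ 1 ^ i / (i.factorial : ℝ) * |t| ^ i * (i.factorial * G ^ i) := by
        gcongr
        exact hG i
    _ = _ := by
        field_simp
        simp

/-- Column `j` of `exp(tH) A exp(-tH)` in the eigenbasis has entries `exp(t(h i - h j)) A i j`, and
its Euclidean norm is at most `3/2`. The bound passes to the limit of the truncations. -/
theorem sum_norm_sq_mul_exp_le {n : ℕ} {H A U : Op n} {h : (Fin n → Fin 2) → ℝ}
    (hU : U * Uᴴ = 1) (hH : basisConj U H = Matrix.diagonal fun i => (h i : ℂ)) {G t : ℝ}
    (hG : ∀ i, opNorm (nestedComm H A i) ≤ i.factorial * G ^ i) (ht : |t| * G = 1 / 3)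
    (j : Fin n → Fin 2) :
    ∑ i, Real.exp (2 * (t * (h i - h j))) * ‖basisConj U A i j‖ ^ 2 ≤ 9 / 4 := by
  have h1 : ∀ N : ℕ, ∑ i, ((expTaylor N).eval (t * (h i - h j))) ^ 2 * ‖basisConj U A i j‖ ^ 2
      ≤ 9 / 4 := fun N => by
    have h2 := sum_norm_sq_col_le (basisConj U (commPoly (expTaylor N) ((t : ℂ) • H) A)) j
    have h3 := (opNorm_basisConj_le hU _).trans (opNorm_commPoly_expTaylor_le hG ht N)
    have h4 : opNorm (basisConj U (commPoly (expTaylor N) ((t : ℂ) • H) A)) ^ 2 ≤ (3 / 2) ^ 2 :=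
      pow_le_pow_left₀ (norm_nonneg _) h3 2
    simp only [basisConj_commPoly_apply hU hH, norm_mul, mul_pow, Complex.norm_real,
      Real.norm_eq_abs, sq_abs] at h2
    exact h2.trans (h4.trans (by norm_num))
  refine le_of_tendsto' (x := Filter.atTop) (tendsto_finsetSum _ fun i _ => ?_) h1
  have := ((tendsto_eval_expTaylor (t * (h i - h j))).pow 2).mul_const (‖basisConj U A i j‖ ^ 2)
  rwa [← Real.exp_nat_mul] at this

/-- The decay of matrix entries away from equal energies: add the bounds for `t = s` and `t = -s`.
-/
theorem sum_norm_sq_mul_exp_abs_le {n : ℕ} {H A U : Op n} {h : (Fin n → Fin 2) → ℝ}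
    (hU : U * Uᴴ = 1) (hH : basisConj U H = Matrix.diagonal fun i => (h i : ℂ)) {G s : ℝ}
    (hG : ∀ i, opNorm (nestedComm H A i) ≤ i.factorial * G ^ i) (hs : 0 < s) (hsG : s * G = 1 / 3)
    (j : Fin n → Fin 2) :
    ∑ i, Real.exp (2 * (s * |h i - h j|)) * ‖basisConj U A i j‖ ^ 2 ≤ 9 / 2 := by
  have h1 := sum_norm_sq_mul_exp_le hU hH hG (t := s) (by rwa [abs_of_pos hs]) j
  have h2 := sum_norm_sq_mul_exp_le hU hH hG (t := -s) (by rwa [abs_neg, abs_of_pos hs]) j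
  have h3 := add_le_add h1 h2
  rw [← Finset.sum_add_distrib] at h3
  refine (Finset.sum_le_sum fun i _ => ?_).trans (h3.trans (by norm_num))
  rw [← add_mul]
  gcongr
  rcases abs_cases (h i - h j) with ⟨e, -⟩ | ⟨e, -⟩ <;> rw [e]
  · linarith [Real.exp_pos (2 * (-s * (h i - h j)))]
  · have : s * -(h i - h j) = -s * (h i - h j) := by ring
    rw [this]
    linarith [Real.exp_pos (2 * (s * (h i - h j)))]

/-- A sum over matrix entries that are weighted by the probabilities of the columns. -/
theorem sum_mul_mul_le {ι : Type*} [Fintype ι] {ρ : ι → ℝ} (hρ : ∀ j, 0 ≤ ρ j)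
    (hρ1 : ∑ j, ρ j = 1) {a b w : ι → ι → ℝ} {M : ℝ} (hw : ∀ i j, 0 ≤ w i j)
    (ha : ∀ j, ∑ i, w i j * a i j ^ 2 ≤ M) (hb : ∀ j, ∑ i, w i j * b i j ^ 2 ≤ M) :
    ∑ j, ∑ i, b i j * a i j * w i j * ρ j ≤ M := by
  calc ∑ j, ∑ i, b i j * a i j * w i j * ρ j
      ≤ ∑ j, ρ j * ((∑ i, w i j * a i j ^ 2 + ∑ i, w i j * b i j ^ 2) / 2) := by
        refine Finset.sum_le_sum fun j _ => ?_
        rw [← Finset.sum_add_distrib, Finset.sum_div, Finset.mul_sum]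
        refine Finset.sum_le_sum fun i _ => ?_
        have h1 := mul_nonneg (mul_nonneg (hw i j) (hρ j)) (sq_nonneg (a i j - b i j))
        nlinarith
    _ ≤ ∑ j, ρ j * M := by
        refine Finset.sum_le_sum fun j _ => ?_
        have := hρ j
        gcongr
        linarith [ha j, hb j]
    _ = M := by rw [← Finset.sum_mul, hρ1, one_mul]

/-- The first term handles `|x| ≤ κ`. The other two handle large `|x|`, where the exponential weight
is affordable because of the decay of the matrix entries. -/
theorem IsFlatExpApprox.abs_sub_mul_gibbsWeight_le {q : ℝ[X]} {κ η ε : ℝ}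
    (hq : IsFlatExpApprox q κ η ε) {n : ℕ} (h : (Fin n → Fin 2) → ℝ) {β s : ℝ} (hβ : 0 < β)
    (hκ : β * Real.log (1 / ε) ≤ s * κ) (hη : η * β ≤ s) (i j : Fin n → Fin 2) :
    |q.eval (-β * (h i - h j)) - Real.exp (-β * (h i - h j))| * gibbsWeight β h j
      ≤ ε * gibbsWeight β h j + 2 * ε * (Real.exp (2 * (s * |h i - h j|)) * gibbsWeight β h j)
        + 2 * ε * (Real.exp (2 * (s * |h i - h j|)) * gibbsWeight β h i) := by
  obtain ⟨hε, hε1⟩ := hq.eps_mem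
  have hη0 := hq.eta_mem.1
  have hκ0 := hq.one_le_kappa
  have hi := gibbsWeight_nonneg β h i
  have hj := gibbsWeight_nonneg β h j
  have hs : 0 < s := lt_of_lt_of_le (by positivity) hη
  set x := -β * (h i - h j) with hx
  have hxabs : |x| = β * |h i - h j| := by rw [hx, abs_mul, abs_neg, abs_of_pos hβ]
  rcases le_or_gt |x| κ with hc | hc
  · have h1 := hq.approx x (abs_le.1 hc)
    have h2 := mul_le_mul_of_nonneg_right h1 hj
    have h3 : 0 ≤ 2 * ε * (Real.exp (2 * (s * |h i - h j|)) * gibbsWeight β h j) := by positivity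
    have h4 : 0 ≤ 2 * ε * (Real.exp (2 * (s * |h i - h j|)) * gibbsWeight β h i) := by positivity
    linarith
  · have h1 : |q.eval x - Real.exp x| ≤ 2 * (max 1 (Real.exp x) * Real.exp (η * |x|)) := by
      have h2 := hq.flat x
      have h3 : Real.exp x ≤ max 1 (Real.exp x) * Real.exp (η * |x|) := by
        calc Real.exp x = Real.exp x * 1 := (mul_one _).symm
          _ ≤ _ := by
            gcongr
            · exact le_max_right _ _
            · exact Real.one_le_exp (by positivity)
      have h4 := abs_sub (q.eval x) (Real.exp x)
      rw [abs_of_pos (Real.exp_pos x)] at h4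
      linarith
    -- One factor `exp(s|h i - h j|)` dominates `exp(η|x|)`, as `ηβ ≤ s`; the other dominates `1/ε`,
    -- as `|x| > κ`.
    have h5 : Real.exp (η * |x|) ≤ ε * Real.exp (2 * (s * |h i - h j|)) := by
      nth_rw 1 [← Real.exp_log hε]
      rw [← Real.exp_add, Real.exp_le_exp]
      rw [one_div, Real.log_inv] at hκ
      have h6 : s * κ < s * (β * |h i - h j|) := by
        rw [← hxabs]
        gcongr
      have h7 : -Real.log ε ≤ s * |h i - h j| := by
        refine le_of_mul_le_mul_left ?_ hβ
        linarith
      have h8 : η * |x| ≤ s * |h i - h j| := by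
        rw [hxabs, ← mul_assoc]
        gcongr
      linarith
    -- Here `exp x` moves the weight from `j` to `i`, so the maximum never produces anything larger
    -- than a Gibbs weight.
    have h9 : max 1 (Real.exp x) * gibbsWeight β h j ≤ gibbsWeight β h j + gibbsWeight β h i := by
      have h10 := exp_mul_gibbsWeight β h i j
      rcases max_cases 1 (Real.exp x) with ⟨e, -⟩ | ⟨e, -⟩ <;> rw [e]
      · linarith
      · rw [hx, h10]
        linarith
    calc |q.eval x - Real.exp x| * gibbsWeight β h j
        ≤ 2 * (max 1 (Real.exp x) * Real.exp (η * |x|)) * gibbsWeight β h j := by gcongr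
      _ = 2 * (Real.exp (η * |x|) * (max 1 (Real.exp x) * gibbsWeight β h j)) := by ring
      _ ≤ 2 * ((ε * Real.exp (2 * (s * |h i - h j|)))
            * (gibbsWeight β h j + gibbsWeight β h i)) := by gcongr
      _ ≤ _ := by nlinarith [mul_nonneg hε.le hj]

theorem IsFlatExpApprox.norm_trace_commPoly_sub_le {q : ℝ[X]} {κ η ε : ℝ}
    (hq : IsFlatExpApprox q κ η ε) {n : ℕ} {H A B : Op n} (hH : H.IsHermitian)
    (hA : A.IsHermitian) (hB : B.IsHermitian) (hA1 : opNorm A ≤ 1) (hB1 : opNorm B ≤ 1) {G β : ℝ}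
    (hG : 0 < G) (hAG : ∀ i, opNorm (nestedComm H A i) ≤ i.factorial * G ^ i)
    (hBG : ∀ i, opNorm (nestedComm H B i) ≤ i.factorial * G ^ i) (hβ : 0 < β)
    (hκ : 3 * G * β * Real.log (1 / ε) ≤ κ) (hη : 3 * G * β * η ≤ 1) :
    ‖(B * commPoly q (-(β : ℂ) • H) A * gibbs β H).trace - (A * B * gibbs β H).trace‖
      ≤ 19 * ε := by
  obtain ⟨U, h, hU, hd⟩ := exists_diagonalizing_basis hH
  set ρ := gibbsWeight β h
  have hρ : ∀ j, 0 ≤ ρ j := gibbsWeight_nonneg β h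
  have hρ1 : ∑ j, ρ j = 1 := sum_gibbsWeight β h
  set s := 1 / (3 * G)
  have hs : 0 < s := by positivity
  have hsG : s * G = 1 / 3 := by
    simp only [s]
    field_simp
  have hs3 : s * (3 * G) = 1 := by linarith
  set a : (Fin n → Fin 2) → (Fin n → Fin 2) → ℝ := fun i j => ‖basisConj U A i j‖
  set b : (Fin n → Fin 2) → (Fin n → Fin 2) → ℝ := fun i j => ‖basisConj U B i j‖
  have hsymm : ∀ {X : Op n}, X.IsHermitian → ∀ i j,
      ‖basisConj U X i j‖ = ‖basisConj U X j i‖ := fun hX i j => by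
    rw [← (basisConj_isHermitian (U := U) hX).apply i j, norm_star]
  have hcol : ∀ {X : Op n}, opNorm X ≤ 1 → ∀ j, ∑ i, 1 * ‖basisConj U X i j‖ ^ 2 ≤ 1 :=
    fun {X} hX j => by
      simp only [one_mul]
      exact (sum_norm_sq_col_le _ j).trans
        (pow_le_one₀ (norm_nonneg _) ((opNorm_basisConj_le hU X).trans hX))
  set W : (Fin n → Fin 2) → (Fin n → Fin 2) → ℝ := fun i j => Real.exp (2 * (s * |h i - h j|))
  have hW : ∀ i j, 0 ≤ W i j := fun i j => (Real.exp_pos _).le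
  have hWs : ∀ i j, W i j = W j i := fun i j => by simp only [W, abs_sub_comm (h i)]
  have b1 : ∑ j, ∑ i, b i j * a i j * 1 * ρ j ≤ 1 :=
    sum_mul_mul_le hρ hρ1 (w := fun _ _ => 1) (fun _ _ => zero_le_one) (hcol hA1) (hcol hB1)
  have b2 : ∑ j, ∑ i, b i j * a i j * W i j * ρ j ≤ 9 / 2 :=
    sum_mul_mul_le hρ hρ1 hW (sum_norm_sq_mul_exp_abs_le hU hd hAG hs hsG)
      (sum_norm_sq_mul_exp_abs_le hU hd hBG hs hsG)
  -- Transposition turns row weights into column weights, since `A` and `B` are Hermitian.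
  have b3 : ∑ j, ∑ i, b i j * a i j * W i j * ρ i ≤ 9 / 2 := by
    rw [Finset.sum_comm]
    refine le_trans (le_of_eq ?_) b2
    refine Finset.sum_congr rfl fun j _ => Finset.sum_congr rfl fun i _ => ?_
    simp only [a, b]
    rw [hsymm hB j i, hsymm hA j i, hWs j i]
  have hpt : ∀ i j, |q.eval (-β * (h i - h j)) - Real.exp (-β * (h i - h j))| * ρ j
      ≤ ε * ρ j + 2 * ε * (W i j * ρ j) + 2 * ε * (W i j * ρ i) := by
    refine hq.abs_sub_mul_gibbsWeight_le h hβ ?_ ?_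
    · have := mul_le_mul_of_nonneg_left hκ hs.le
      linear_combination this - β * Real.log (1 / ε) * hs3
    · have := mul_le_mul_of_nonneg_left hη hs.le
      linear_combination this - η * β * hs3
  have hneg : -(β : ℂ) • H = ((-β : ℝ) : ℂ) • H := by simp
  have t1 : (B * commPoly q (-(β : ℂ) • H) A * gibbs β H).trace
      = ∑ j, ∑ i, basisConj U B j i * (((q.eval (-β * (h i - h j)) : ℝ) : ℂ) * basisConj U A i j)
        * (ρ j : ℂ) := by
    rw [← trace_basisConj hU, basisConj_mul hU, basisConj_mul hU, basisConj_gibbs hU hd, hneg,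
      Matrix.trace]
    refine Finset.sum_congr rfl fun j _ => ?_
    rw [Matrix.diag_apply, Matrix.mul_diagonal, Matrix.mul_apply, Finset.sum_mul]
    refine Finset.sum_congr rfl fun i _ => ?_
    rw [basisConj_commPoly_apply hU hd]
  -- The product `A B ρ` naturally carries `ρ i`; rewriting it through `ρ j` brings in the exact
  -- exponential.
  have t2 : (A * B * gibbs β H).trace
      = ∑ j, ∑ i, basisConj U B j i * (((Real.exp (-β * (h i - h j)) : ℝ) : ℂ) * basisConj U A i j)
        * (ρ j : ℂ) := by
    rw [← trace_basisConj hU, basisConj_mul hU, basisConj_mul hU, basisConj_gibbs hU hd,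
      Matrix.trace, Finset.sum_comm]
    refine Finset.sum_congr rfl fun i _ => ?_
    rw [Matrix.diag_apply, Matrix.mul_diagonal, Matrix.mul_apply, Finset.sum_mul]
    refine Finset.sum_congr rfl fun j _ => ?_
    rw [← exp_mul_gibbsWeight β h i j]
    push_cast
    ring
  rw [t1, t2, ← Finset.sum_sub_distrib]
  simp only [← Finset.sum_sub_distrib]
  refine (norm_sum_le _ _).trans ((Finset.sum_le_sum fun j _ => norm_sum_le _ _).trans ?_)
  calc _ ≤ ∑ j, ∑ i, (ε * (b i j * a i j * 1 * ρ j) + 2 * ε * (b i j * a i j * W i j * ρ j)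
        + 2 * ε * (b i j * a i j * W i j * ρ i)) := by
        refine Finset.sum_le_sum fun j _ => Finset.sum_le_sum fun i _ => ?_
        have e : ∀ u v : ℝ, basisConj U B j i * ((u : ℂ) * basisConj U A i j) * (ρ j : ℂ)
            - basisConj U B j i * ((v : ℂ) * basisConj U A i j) * (ρ j : ℂ)
            = basisConj U B j i * basisConj U A i j * (((u - v) * ρ j : ℝ) : ℂ) := fun u v => by
          push_cast
          ring
        rw [e, norm_mul, norm_mul, Complex.norm_real, Real.norm_eq_abs, abs_mul,
          abs_of_nonneg (hρ j), hsymm hB j i]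
        have := mul_le_mul_of_nonneg_left (hpt i j)
          (mul_nonneg (norm_nonneg (basisConj U B i j)) (norm_nonneg (basisConj U A i j)))
        refine this.trans (le_of_eq ?_)
        simp only [a, b]
        ring
    _ = ε * ∑ j, ∑ i, b i j * a i j * 1 * ρ j + 2 * ε * ∑ j, ∑ i, b i j * a i j * W i j * ρ j
        + 2 * ε * ∑ j, ∑ i, b i j * a i j * W i j * ρ i := by
        simp only [Finset.sum_add_distrib, Finset.mul_sum]
    _ ≤ ε * 1 + 2 * ε * (9 / 2) + 2 * ε * (9 / 2) := by
        have := hq.eps_mem.1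
        gcongr
    _ = 19 * ε := by ring

/-! ### Feasibility for local Hamiltonians -/

namespace LocalHamiltonian

variable {n m k d : ℕ} (H : LocalHamiltonian n m k d)

theorem opNorm_nestedComm_le {A : PauliString n} (hA : A ∈ coveredBy H.term 4) (i : ℕ) :
    opNorm (nestedComm H.op A.op i) ≤ i.factorial * (8 * ((d : ℝ) + 1)) ^ i :=
  (H.pauliSum_nestedComm hA i).opNorm_le

theorem norm_trace_commPoly_sub_le {q : ℝ[X]} {κ η ε β : ℝ} (hq : IsFlatExpApprox q κ η ε)
    {A B : PauliString n} (hA : A ∈ coveredBy H.term 4) (hB : B ∈ coveredBy H.term 4)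
    (hβ : 0 < β) (hκ : 3 * (8 * ((d : ℝ) + 1)) * β * Real.log (1 / ε) ≤ κ)
    (hη : 3 * (8 * ((d : ℝ) + 1)) * β * η ≤ 1) :
    ‖(B.op * commPoly q (-(β : ℂ) • H.op) A.op * gibbs β H.op).trace
      - (A.op * B.op * gibbs β H.op).trace‖ ≤ 19 * ε :=
  hq.norm_trace_commPoly_sub_le H.op_isHermitian A.op_isHermitian B.op_isHermitian
    A.opNorm_op.le B.opNorm_op.le (by positivity) (H.opNorm_nestedComm_le hA)
    (H.opNorm_nestedComm_le hB) hβ hκ hη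

end LocalHamiltonian

theorem pos_of_mem_graphLocal {n m k r : ℕ} {E : Fin m → PauliString n} {P : PauliString n}
    (hP : P ∈ graphLocal E k r) : 0 < m := by
  obtain ⟨S, h1, -⟩ := hP
  obtain ⟨a⟩ := h1.nonempty
  exact a.1.pos

/-! ### Estimates for the exponential constraints -/

/-- The error of the estimates `T` of `M ↦ tr (M ρ)`. -/
noncomputable def estimateError {n : ℕ} (T : Op n →ₗ[ℂ] ℂ) (ρ : Op n) : Op n →ₗ[ℂ] ℂ :=
  T - (Matrix.traceLinearMap (Fin n → Fin 2) ℂ ℂ) ∘ₗ LinearMap.mulRight ℂ ρ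

theorem estimateError_apply {n : ℕ} (T : Op n →ₗ[ℂ] ℂ) (ρ M : Op n) :
    estimateError T ρ M = T M - (M * ρ).trace := rfl

theorem sum_range_pow_add_one_le {x : ℝ} (hx : 2 ≤ x) (N : ℕ) :
    ∑ i ∈ Finset.range N, x ^ i + 1 ≤ x ^ N := by
  induction N with
  | zero => simp
  | succ N ih =>
    rw [Finset.sum_range_succ, pow_succ]
    have : 0 ≤ x ^ N := by positivity
    nlinarith

/-- The coefficient bound `1/i!` cancels the factorial growth of nested commutators. The extra `1`
reserves room for the error of the second estimate in the constraint. -/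
theorem IsExpTrunc.sum_support_mul_factorial_le {p : ℝ[X]} {N : ℕ} (hp : IsExpTrunc p 1 N)
    {b g x : ℝ} (hg : 0 ≤ g) (hb : |b| * g ≤ x) (hx : 2 ≤ x) {D : ℕ} (hD : p.natDegree ≤ D) :
    ∑ i ∈ p.support, |p.coeff i| * |b| ^ i * (i.factorial * g ^ i) + 1 ≤ x ^ (D + 1) := by
  have h1 : p.support ⊆ Finset.range (D + 1) := fun i hi => by
    have := Polynomial.le_natDegree_of_mem_supp i hi
    exact Finset.mem_range.2 (by omega)
  have h2 : ∑ i ∈ p.support, |p.coeff i| * |b| ^ i * (i.factorial * g ^ i)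
      ≤ ∑ i ∈ p.support, x ^ i := by
    refine Finset.sum_le_sum fun i _ => ?_
    obtain ⟨h0, h1, -⟩ := hp i
    rw [abs_of_nonneg h0]
    have hf : (0 : ℝ) < i.factorial := by positivity
    calc p.coeff i * |b| ^ i * (i.factorial * g ^ i)
        ≤ 1 ^ i / (i.factorial : ℝ) * |b| ^ i * (i.factorial * g ^ i) := by gcongr
      _ = (|b| * g) ^ i := by
          rw [mul_pow]
          field_simp
          simp
      _ ≤ x ^ i := by gcongr
  have h3 := Finset.sum_le_sum_of_subset_of_nonneg (f := fun i => x ^ i) h1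
    fun i _ _ => by positivity
  linarith [sum_range_pow_add_one_le hx (D + 1)]

theorem forty_mul_sq_le_two_pow {K : ℕ} (hK : 20 ≤ K) : 40 * K ^ 2 ≤ 2 ^ K := by
  induction K, hK using Nat.le_induction with
  | base => norm_num
  | succ K hK ih =>
    rw [pow_succ 2]
    nlinarith

theorem mul_four_pow_le_ten_pow {K : ℕ} (hK : 6 ≤ K) : K * 4 ^ (K + 2) + 3 ≤ 10 ^ K := by
  induction K, hK using Nat.le_induction with
  | base => norm_num
  | succ K hK ih =>
    have e1 : 4 ^ (K + 1 + 2) = 4 * 4 ^ (K + 2) := by ring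
    have e2 : 10 ^ (K + 1) = 10 * 10 ^ K := by ring
    rw [e1, e2]
    have : 0 < 4 ^ (K + 2) := by positivity
    nlinarith

theorem half_le_log_one_div {ε : ℝ} (hε : 0 < ε) (hε2 : ε ≤ 1 / 2) :
    1 / 2 ≤ Real.log (1 / ε) := by
  have h1 : Real.log 2 ≤ Real.log (1 / ε) := Real.log_le_log (by norm_num) (by
    rw [le_one_div (by norm_num) hε]
    exact hε2)
  linarith [Real.log_two_gt_d9]

/-- In terms of `L = log(1/ε)` the power of `K` costs at most `exp(K 4 ^ (K+2) L)` and the accuracy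
gains `exp(-10 ^ K L)`; the surplus is at least `3 L`, and `ε ^ 3 ≤ ε / 4`. -/
theorem pow_mul_sysEps_le {K m : ℕ} (hK : 6 ≤ K) (hm : 0 < m) {ε : ℝ} (hε : 0 < ε)
    (hε2 : ε ≤ 1 / 2) :
    (K : ℝ) ^ (2 ^ (K + 1) * sysL K ε + 1) * sysEps K m ε ≤ ε / 4 := by
  set L := Real.log (1 / ε) with hL
  have hLε : Real.log ε = -L := by rw [hL, one_div, Real.log_inv, neg_neg]
  have hL2 : 1 / 2 ≤ L := half_le_log_one_div hε hε2
  have h2K : (2 : ℝ) ≤ 2 ^ K := by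
    calc (2 : ℝ) = 2 ^ 1 := by norm_num
      _ ≤ 2 ^ K := pow_le_pow_right₀ (by norm_num) (by omega)
  have hl : (sysL K ε : ℝ) ≤ 2 ^ (K + 1) * L := by
    have := (Nat.ceil_lt_add_one (a := (2 : ℝ) ^ K * L) (by positivity)).le
    rw [sysL, pow_succ]
    nlinarith
  have hD : ((2 ^ (K + 1) * sysL K ε + 1 : ℕ) : ℝ) ≤ 4 ^ (K + 2) * L := by
    have e : (4 : ℝ) ^ (K + 1) = 2 ^ (K + 1) * 2 ^ (K + 1) := by
      rw [← mul_pow]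
      norm_num
    have h4 : (2 : ℝ) ≤ 4 ^ (K + 1) := by
      rw [e, pow_succ]
      nlinarith
    push_cast
    calc (2 : ℝ) ^ (K + 1) * sysL K ε + 1 ≤ 2 ^ (K + 1) * (2 ^ (K + 1) * L) + 1 := by gcongr
      _ = 4 ^ (K + 1) * L + 1 := by
          rw [e]
          ring
      _ ≤ 4 * (4 ^ (K + 1) * L) := by nlinarith
      _ = _ := by ring
  have h1 : (K : ℝ) ^ (2 ^ (K + 1) * sysL K ε + 1) ≤ Real.exp (K * (4 ^ (K + 2) * L)) := by
    calc (K : ℝ) ^ (2 ^ (K + 1) * sysL K ε + 1)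
        ≤ Real.exp K ^ (2 ^ (K + 1) * sysL K ε + 1) := by
          gcongr
          linarith [Real.add_one_le_exp (K : ℝ)]
      _ = Real.exp (K * ((2 ^ (K + 1) * sysL K ε + 1 : ℕ) : ℝ)) := by
          rw [← Real.exp_nat_mul, mul_comm]
      _ ≤ _ := by gcongr
  have h2 : sysEps K m ε ≤ Real.exp (-(10 ^ K * L)) := by
    have hm1 : (1 : ℝ) ≤ (m : ℝ) ^ 3 := one_le_pow₀ (by exact_mod_cast hm)
    calc sysEps K m ε ≤ ε ^ (10 ^ K) := div_le_self (by positivity) hm1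
      _ = Real.exp (Real.log ε) ^ (10 ^ K) := by rw [Real.exp_log hε]
      _ = _ := by
          rw [← Real.exp_nat_mul, hLε]
          push_cast
          ring_nf
  have h3 : (K : ℝ) * 4 ^ (K + 2) + 3 ≤ 10 ^ K := by exact_mod_cast mul_four_pow_le_ten_pow hK
  have h4 : 0 ≤ sysEps K m ε := by
    unfold sysEps
    positivity
  calc _ ≤ Real.exp (K * (4 ^ (K + 2) * L)) * Real.exp (-(10 ^ K * L)) := by gcongr
    _ ≤ Real.exp ((3 : ℕ) * Real.log ε) := by
        rw [← Real.exp_add, Real.exp_le_exp, hLε]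
        push_cast
        nlinarith
    _ = ε ^ 3 := by rw [Real.exp_nat_mul, Real.exp_log hε]
    _ ≤ ε / 4 := by
        have : ε ^ 2 ≤ (1 / 2) ^ 2 := by gcongr
        nlinarith

theorem le_sysL (K : ℕ) (ε : ℝ) : (2 : ℝ) ^ K * Real.log (1 / ε) ≤ sysL K ε := Nat.le_ceil _

theorem twenty_mul_sq_le_sysL {K : ℕ} (hK : 20 ≤ K) {ε : ℝ} (hε : 0 < ε) (hε2 : ε ≤ 1 / 2) :
    20 * K ^ 2 ≤ sysL K ε := by
  have h1 : (40 : ℝ) * K ^ 2 ≤ 2 ^ K := by exact_mod_cast forty_mul_sq_le_two_pow hK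
  have h2 := half_le_log_one_div hε hε2
  have h3 := le_sysL K ε
  have h4 : (0 : ℝ) < 2 ^ K := by positivity
  have : (20 : ℝ) * K ^ 2 ≤ sysL K ε := by nlinarith
  exact_mod_cast this

/-- Ensures that every Pauli in `q(-βH|B₁)` lies in the set on which the estimates are accurate. -/
theorem mul_four_add_le {k K l i : ℕ} (hK : k + 2 ≤ K) (hl : 1 ≤ l) (hi : i ≤ 2 ^ (K + 1) * l) :
    k * (4 + i) ≤ 4 ^ K * l := by
  obtain ⟨e, rfl⟩ := Nat.exists_eq_add_of_le hK
  have h1 : k ≤ 2 ^ (k + e) :=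
    Nat.lt_two_pow_self.le.trans (Nat.pow_le_pow_right (by norm_num) (by omega))
  have h2 : 4 ≤ 2 ^ (k + 2 + e + 1) * l := by
    calc 4 = 2 ^ 2 * 1 := by norm_num
      _ ≤ _ := Nat.mul_le_mul (Nat.pow_le_pow_right (by norm_num) (by omega)) hl
  calc k * (4 + i) ≤ 2 ^ (k + e) * (2 ^ (k + 2 + e + 1) * l + 2 ^ (k + 2 + e + 1) * l) := by
        gcongr
    _ = 4 ^ (k + 2 + e) * l := by
        have e4 : 4 ^ (k + 2 + e) = 2 ^ (k + 2 + e) * 2 ^ (k + 2 + e) := by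
          rw [← mul_pow]
          norm_num
        rw [e4]
        ring

/-! ### The constraints of the system at the true coefficients -/

namespace LocalHamiltonian

variable {n m k d : ℕ} (H : LocalHamiltonian n m k d)

/-- The exact trace vanishes because `H` commutes with its Gibbs state. Each of the two products
expands into `m` triples of Paulis with coefficients at most `1`. -/
theorem norm_estimate_commutator_le {T : Op n →ₗ[ℂ] ℂ} {β δ : ℝ} {S : Set (PauliString n)}
    (hS : ∀ a, H.term a ∈ S) (hT : AccurateEstimates T (gibbs β H.op) S δ)
    {A₁ A₂ : PauliString n} (hA₁ : A₁ ∈ S) (hA₂ : A₂ ∈ S) :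
    ‖T (A₁.op * A₂.op * H.op - H.op * (A₁.op * A₂.op))‖ ≤ 2 * m * δ := by
  set g := estimateError T (gibbs β H.op)
  have hδ : 0 ≤ δ := (norm_nonneg _).trans (hT A₁ hA₁ A₁ hA₁ A₁ hA₁)
  have hg : ∀ P ∈ S, ∀ Q ∈ S, ∀ R ∈ S, ‖g (P.op * Q.op * R.op)‖ ≤ δ := hT
  have h0 : T (A₁.op * A₂.op * H.op - H.op * (A₁.op * A₂.op))
      = g (A₁.op * A₂.op * H.op) - g (H.op * (A₁.op * A₂.op)) := by
    have htr : ∀ X : Op n, (X * H.op * gibbs β H.op).trace = (H.op * X * gibbs β H.op).trace :=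
      fun X => by
        rw [mul_assoc X, ← (gibbs_commute β H.op).eq, ← mul_assoc, Matrix.trace_mul_comm _ H.op,
          ← mul_assoc]
    rw [← map_sub, estimateError_apply, sub_mul, Matrix.trace_sub, htr, sub_self, sub_zero]
  have hsum : ∀ X : Fin m → Op n, (∀ a, ‖g (X a)‖ ≤ δ) →
      ‖g (∑ a, (H.coeff a : ℂ) • X a)‖ ≤ m * δ := fun X hX => by
    rw [map_sum]
    refine (norm_sum_le _ _).trans ?_
    calc ∑ a, ‖g ((H.coeff a : ℂ) • X a)‖ ≤ ∑ _a : Fin m, δ := by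
          refine Finset.sum_le_sum fun a _ => ?_
          rw [map_smul, norm_smul, Complex.norm_real, Real.norm_eq_abs]
          calc |H.coeff a| * ‖g (X a)‖ ≤ 1 * δ := by
                gcongr
                · exact H.abs_coeff_le a
                · exact hX a
            _ = δ := one_mul δ
      _ = m * δ := by simp
  have e1 : A₁.op * A₂.op * H.op = ∑ a, (H.coeff a : ℂ) • (A₁.op * A₂.op * (H.term a).op) := by
    simp only [LocalHamiltonian.op, hamOp, Finset.mul_sum, mul_smul_comm]
  have e2 : H.op * (A₁.op * A₂.op) = ∑ a, (H.coeff a : ℂ) • ((H.term a).op * A₁.op * A₂.op) := by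
    simp only [LocalHamiltonian.op, hamOp, Finset.sum_mul, smul_mul_assoc, mul_assoc]
  rw [h0]
  have h1 := hsum _ fun a => hg _ hA₁ _ hA₂ _ (hS a)
  have h2 := hsum _ fun a => hg _ (hS a) _ hA₁ _ hA₂
  rw [← e1] at h1
  rw [← e2] at h2
  linarith [norm_sub_le (g (A₁.op * A₂.op * H.op)) (g (H.op * (A₁.op * A₂.op)))]

theorem norm_estimateError_mul_commPoly_le {T : Op n →ₗ[ℂ] ℂ} {ρ : Op n} {β δ : ℝ}
    {S : Set (PauliString n)} (hT : AccurateEstimates T ρ S δ) (h0 : 0 ∈ S) (q : ℝ[X])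
    (hS : ∀ i ≤ q.natDegree, coveredBy H.term (4 + i) ⊆ S) {A B : PauliString n}
    (hA : A ∈ coveredBy H.term 4) (hB : B ∈ S) :
    ‖estimateError T ρ (B.op * commPoly q (-(β : ℂ) • H.op) A.op)‖
      ≤ (∑ i ∈ q.support, |q.coeff i| * |-β| ^ i
          * (i.factorial * (8 * ((d : ℝ) + 1)) ^ i)) * δ := by
  have hδ : 0 ≤ δ := (norm_nonneg _).trans (hT 0 h0 0 h0 0 h0)
  set N : Seminorm ℂ (Op n) :=
    (normSeminorm ℂ ℂ).comp (estimateError T ρ ∘ₗ LinearMap.mulLeft ℂ B.op) with hN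
  have hNa : ∀ X, N X = ‖estimateError T ρ (B.op * X)‖ := fun X => rfl
  have hneg : -(β : ℂ) • H.op = ((-β : ℝ) : ℂ) • H.op := by simp
  rw [← hNa, hneg]
  refine (seminorm_commPoly_le N q (-β) H.op A.op).trans ?_
  rw [Finset.sum_mul]
  refine Finset.sum_le_sum fun i hi => ?_
  rw [mul_assoc _ _ δ]
  gcongr
  refine (H.pauliSum_nestedComm hA i).seminorm_le N hδ fun P hP => ?_
  -- The identity string fills the third slot of the triple.
  have := hT B hB P (hS i (Polynomial.le_natDegree_of_mem_supp i hi) hP) 0 h0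
  rw [PauliString.op_zero, mul_one] at this
  exact this

/-- The constant `400` exceeds `3 * 114 = 342`, as flatness with `η = 114/K` requires; `200 + k`
covers `114 < K` and `k + 2 ≤ K`. -/
theorem satisfiesSystem {K : ℕ} (hK : 200 + k ≤ K) {β ε δ τ : ℝ} (hβ : 0 < β)
    (hβK : 400 * (8 * ((d : ℝ) + 1)) * β ≤ K) (hε : 0 < ε) (hε2 : ε ≤ 1 / 2)
    {T : Op n →ₗ[ℂ] ℂ} (hδ : δ ≤ sysEps K m ε) (hτ : 2 * m * δ ≤ τ)
    (hT : AccurateEstimates T (gibbs β H.op) (sysA H.term k K ε) δ) :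
    SatisfiesSystem H.term k K β ε τ T H.coeff := by
  have hl20 := twenty_mul_sq_le_sysL (by omega : 20 ≤ K) hε hε2
  have hL := half_le_log_one_div hε hε2
  have hlL := le_sysL K ε
  have h40 : (40 : ℝ) * K ^ 2 ≤ 2 ^ K := by
    exact_mod_cast forty_mul_sq_le_two_pow (by omega : 20 ≤ K)
  set l := sysL K ε with hl
  have hl1 : 1 ≤ l := by nlinarith
  have hsub : ∀ i ≤ 2 ^ (K + 1) * l, coveredBy H.term (4 + i) ⊆ sysA H.term k K ε := fun i hi =>
    coveredBy_subset_graphLocal _ (mul_four_add_le (by omega) hl1 hi)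
  have hsub4 := hsub 0 (Nat.zero_le _)
  refine ⟨fun a => abs_le.1 (H.abs_coeff_le a), fun A₁ hA₁ A₂ hA₂ => ?_, fun B₁ hB₁ B₂ hB₂ => ?_⟩
  · have h := H.norm_estimate_commutator_le
      (fun a => hsub4 (term_mem_coveredBy H.term a (by norm_num))) hT hA₁ hA₂
    exact pow_le_pow_left₀ (norm_nonneg _) (h.trans hτ) 2
  · have hm := pos_of_mem_graphLocal hB₁
    rw [sysB, mul_comm] at hB₁ hB₂
    replace hB₁ := H.graphLocal_subset_coveredBy 4 hB₁
    replace hB₂ := H.graphLocal_subset_coveredBy 4 hB₂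
    have h0 : (0 : PauliString n) ∈ sysA H.term k K ε :=
      hsub4 (zero_mem_coveredBy H.term hm (by norm_num))
    have hδ0 : 0 ≤ δ := (norm_nonneg _).trans (hT 0 h0 0 h0 0 h0)
    refine pow_le_pow_left₀ (norm_nonneg _) ?_ 2
    set q := iterTaylorInt K l
    set Q := commPoly q (-(β : ℂ) • H.op) B₁.op
    set g := estimateError T (gibbs β H.op)
    have hdeg : q.natDegree ≤ 2 ^ (K + 1) * l := natDegree_iterTaylorInt_le K hl1
    have hK200 : (200 : ℝ) ≤ K := by exact_mod_cast (by omega : 200 ≤ K)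
    have hK0 : (0 : ℝ) < K := by linarith
    have h2K : (0 : ℝ) ≤ 2 ^ K := by positivity
    have hKL : K * Real.log (1 / ε) ≤ l := by nlinarith
    have hlog : Real.log (1 / ε ^ 7) = 7 * Real.log (1 / ε) := by
      rw [one_div, one_div, Real.log_inv, Real.log_inv, Real.log_pow]
      push_cast
      ring
    -- Accuracy `ε ^ 7` instead of `ε` makes the error `19 ε ^ 7 ≤ 19 ε / 64`, which together with
    -- `ε / 4` for the estimates stays below `ε`.
    have hflat : IsFlatExpApprox q (l / 10) (114 / K) (ε ^ 7) :=
      isFlatExpApprox_iterTaylorInt (by omega) hl20 (by positivity)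
        (pow_lt_one₀ hε.le (by linarith) (by norm_num)) (by
          rw [hlog]
          nlinarith)
    have h1 := H.norm_trace_commPoly_sub_le hflat hB₁ hB₂ hβ
      (by
        rw [hlog]
        have := mul_le_mul_of_nonneg_right hβK (by linarith : 0 ≤ Real.log (1 / ε))
        have : 0 ≤ (8 * ((d : ℝ) + 1)) * β * Real.log (1 / ε) := by positivity
        linarith)
      (by
        rw [← mul_div_assoc, div_le_one hK0]
        have : 0 ≤ (8 * ((d : ℝ) + 1)) * β := by positivity
        linarith)
    have h2 := H.norm_estimateError_mul_commPoly_le (β := β) hT h0 q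
      (fun i hi => hsub i (hi.trans hdeg)) hB₁ (hsub4 hB₂)
    have h3 : ‖g (B₁.op * B₂.op)‖ ≤ δ := by
      have := hT B₁ (hsub4 hB₁) B₂ (hsub4 hB₂) 0 h0
      rw [PauliString.op_zero, mul_one] at this
      exact this
    have h4 := (isExpTrunc_iterTaylorInt (by omega : 1 ≤ K) l).sum_support_mul_factorial_le
      (b := -β) (g := 8 * ((d : ℝ) + 1)) (x := K) (by positivity) (by
        rw [abs_neg, abs_of_pos hβ]
        have : 0 ≤ (8 * ((d : ℝ) + 1)) * β := by positivity
        linarith) (by linarith) hdeg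
    have h5 := pow_mul_sysEps_le (by omega : 6 ≤ K) hm hε hε2
    have h6 : ‖g (B₂.op * Q)‖ + ‖g (B₁.op * B₂.op)‖ ≤ ε / 4 := by
      have h7 := mul_le_mul h4 hδ hδ0 (by positivity)
      rw [add_mul, one_mul] at h7
      linarith
    have h8 : ε ^ 7 ≤ ε / 64 := by
      have : ε ^ 6 ≤ (1 / 2) ^ 6 := by gcongr
      nlinarith
    have e : T (B₂.op * Q) - T (B₁.op * B₂.op)
        = g (B₂.op * Q) - g (B₁.op * B₂.op) + ((B₂.op * Q * gibbs β H.op).trace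
          - (B₁.op * B₂.op * gibbs β H.op).trace) := by
      rw [estimateError_apply, estimateError_apply]
      ring
    change ‖T (B₂.op * Q) - T (B₁.op * B₂.op)‖ ≤ ε
    rw [e]
    refine (norm_add_le _ _).trans ?_
    linarith [norm_sub_le (g (B₂.op * Q)) (g (B₁.op * B₂.op))]

end LocalHamiltonian

end HamiltonianLearning

/-! ### Choice of the constants -/

theorem mainTheorem9 (k d : ℕ) :
    (∃ C > (0 : ℝ), ∃ c > (0 : ℝ),
      ∀ (n m : ℕ) (H : LocalHamiltonian n m k d) (β : ℝ) (_ : 0 < β)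
        (q : Polynomial ℝ) (κ η ε : ℝ) (_ : IsFlatExpApprox q κ η ε)
        (_ : C * β * Real.log (1 / ε) ≤ κ) (_ : η < c / β)
        (A B : PauliString n) (_ : A ∈ graphLocal H.term k k) (_ : B ∈ graphLocal H.term k k),
        ‖Matrix.trace (B.op * commPoly q (-(β : ℂ) • H.op) A.op * gibbs β H.op)
            - Matrix.trace (A.op * B.op * gibbs β H.op)‖
          ≤ 20 * ε * opNorm A.op * opNorm B.op) ∧
    (∃ C₀ > (0 : ℝ), ∀ C ≥ C₀,
      ∀ (n m : ℕ) (H : LocalHamiltonian n m k d) (β : ℝ) (_ : 1 / (10 * ((d : ℝ) + 1)) ^ 10 < β)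
        (ε : ℝ) (_ : 0 < ε) (_ : ε ≤ 1 / 2)
        (T : Op n →ₗ[ℂ] ℂ) (δ τ : ℝ) (_ : δ ≤ sysEps (sysK C β) m ε) (_ : 2 * m * δ ≤ τ)
        (_ : AccurateEstimates T (gibbs β H.op) (sysA H.term k (sysK C β) ε) δ),
        SatisfiesSystem H.term k (sysK C β) β ε τ T H.coeff) := by
  -- In `C₀`, the first summand turns the lower bound on `β` into `K ≥ 200 + k`, and the second
  -- gives `K ≥ 400 G β` with `G = 8(d+1)`.
  refine ⟨⟨3 * (8 * ((d : ℝ) + 1)), by positivity, 1 / (3 * (8 * ((d : ℝ) + 1))), by positivity,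
    ?_⟩, ⟨(200 + k) * (10 * ((d : ℝ) + 1)) ^ 10 + 400 * (8 * ((d : ℝ) + 1)), by positivity, ?_⟩⟩
  · intro n m H β hβ q κ η ε hq hκ hη A B hA hB
    have hsub : graphLocal H.term k k ⊆ coveredBy H.term 4 := fun P ⟨S, h1, h2, h3⟩ =>
      H.graphLocal_subset_coveredBy 4 ⟨S, h1, h2.trans (by omega), h3⟩
    rw [A.opNorm_op, B.opNorm_op]
    refine (H.norm_trace_commPoly_sub_le hq (hsub hA) (hsub hB) hβ hκ ?_).trans ?_
    · rw [div_div, lt_div_iff₀ (by positivity)] at hη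
      linarith
    · linarith [hq.eps_mem.1]
  · intro C hC n m H β hβ ε hε hε2 T δ τ hδ hτ hT
    have hβ0 : 0 < β := lt_trans (by positivity) hβ
    have h1 : (1 : ℝ) < β * (10 * ((d : ℝ) + 1)) ^ 10 := by
      rwa [div_lt_iff₀ (by positivity)] at hβ
    have h2 : C * β ≤ sysK C β := Nat.le_ceil _
    have h3 := mul_le_mul_of_nonneg_right hC hβ0.le
    have h4 : 0 ≤ 400 * (8 * ((d : ℝ) + 1)) * β := by positivity
    have h5 : (200 + (k : ℝ)) * 1 ≤ (200 + k) * (β * (10 * ((d : ℝ) + 1)) ^ 10) := by gcongr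
    refine H.satisfiesSystem ?_ hβ0 ?_ hε hε2 hδ hτ hT
    · have : (200 : ℝ) + k ≤ sysK C β := by linarith
      exact_mod_cast this
    · have : 0 ≤ (200 + (k : ℝ)) * (β * (10 * ((d : ℝ) + 1)) ^ 10) := by positivity
      linarith
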